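/- Let $\zeta=(\zeta(t))_{t\in\mathbb Z}$ be a real, zero-mean, $p$-dimensional wide-sense stationary process with rational spectral density $\Phi$ (a matrix of rational functions of $z$ with real coefficients and no poles on the unit circle, with $\mathbb E[\zeta(t+k)\zeta(t)']=\frac1{2\pi}\int_{-\pi}^{\pi}e^{ik\theta}\Phi(e^{i\theta})\,d\theta$) of rank $m$. After a permutation of the components let $\zeta=\begin{bmatrix}u\\ y\end{bmatrix}$ with $u$ of dimension $m$, and let $\Phi=\begin{bmatrix}\Phi_u&\Phi_{uy}\\ \Phi_{yu}&\Phi_y\end{bmatrix}$ be the corresponding partition. Suppose that $u$ has full rank, i.e. $\operatorname{rank}\Phi_u=m$. For a rational matrix $G$ and a stationary process $x$ with spectral representation $x(t)=\int_{-\pi}^{\pi} e^{it\theta}\,d\hat x$, write $s=G(z)x$ if $G$ is in $L^2$ with respect to the spectral density of $x$ and $s(t)=\int_{-\pi}^{\pi} e^{it\theta}G(e^{i\theta})\,d\hat x$ for all $t$. Then: 1. There are real rational matrices $F(z)$ of size $(p-m)\times m$ and $H(z)$ of size $m\times(p-m)$, with $H$ proper, and an $m$-dimensional process $r$, such that $$y=F(z)u,\qquad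 u=H(z)y+r,$$ and this feedback model is internally stable: $\begin{bmatrix}I&-H\\-F&I\end{bmatrix}$ is invertible, and its inverse, the closed-loop transfer function from $(r,v)$ to $(u,y)$ in the loop $u=Hy+r$, $y=Fu+v$, is proper with all poles in the open unit disc. 2. $F$ is unique: every real rational $F$ with $y=F(z)u$ equals $\Phi_{yu}\Phi_u^{-1}$. 3. In every internally stable feedback model $y=F(z)u$, $u=H(z)y+r$, with $F$ and $H$ real rational, the input $r$ is a stationary process with a rational spectral density of full rank $m$. -/

import Mathlib

open MeasureTheory Filter Topology

noncomputable section

/-! Second-order (wide-sense) stationary real vector processes in discrete time. A process with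
components indexed by `ι` is a map `x : ℤ → Ω → ι → ℝ`, with `x t ω i` its `i`-th component at
time `t`. Transfer functions and spectral densities are matrices of rational functions in the
shift `z` with real coefficients; since `RatFunc ℝ` is a field, `Matrix.rank` over it is the rank
almost everywhere on the unit circle. -/

/-- Zero mean, finite second moments, and covariances `E[x_i(t+k) x_j(t)]` that do not depend
on `t`. -/
structure IsWideSenseStationary {Ω ι : Type*} [MeasurableSpace Ω] (P : Measure Ω)
    (x : ℤ → Ω → ι → ℝ) : Prop where
  memLp : ∀ t i, MemLp (fun ω => x t ω i) 2 P
  mean_zero : ∀ t i, ∫ ω, x t ω i ∂P = 0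
  cov_shift : ∀ s t k i j,
    ∫ ω, x (s + k) ω i * x s ω j ∂P = ∫ ω, x (t + k) ω i * x t ω j ∂P

/-- The point `e^{iθ}` of the unit circle. -/
def circlePt (θ : ℝ) : ℂ := Complex.exp (θ * Complex.I)

/-- The value `G(e^{iθ})` of a rational matrix function. -/
def onCircle {ι κ : Type*} (G : Matrix ι κ (RatFunc ℝ)) (θ : ℝ) : Matrix ι κ ℂ :=
  G.map fun f => f.eval (algebraMap ℝ ℂ) (circlePt θ)

/-- `Φ` is the rational spectral density of the stationary process `x`:
`E[x_i(t+k) x_j(t)] = (2π)⁻¹ ∫ e^{ikθ} Φ_ij(e^{iθ}) dθ` over `[-π, π]`, where `Φ` has no poles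
on the unit circle. -/
structure IsSpectralDensity {Ω ι : Type*} [MeasurableSpace Ω] (P : Measure Ω)
    (x : ℤ → Ω → ι → ℝ) (Φ : Matrix ι ι (RatFunc ℝ)) : Prop where
  no_pole : ∀ i j (z : ℂ), ‖z‖ = 1 → Polynomial.aeval z (Φ i j).denom ≠ 0
  cov_eq : ∀ (t k : ℤ) (i j : ι),
    ((∫ ω, x (t + k) ω i * x t ω j ∂P : ℝ) : ℂ) =
      (2 * (Real.pi : ℂ))⁻¹ * ∫ θ in (-Real.pi)..Real.pi, circlePt θ ^ k * onCircle Φ θ i j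

/-- A finite impulse response filter `∑ k, a_k z^k` applied to a process, with
`z x(t) = x(t+1)`. -/
def firApply {Ω ι κ : Type*} [Fintype κ] (a : ℤ →₀ Matrix ι κ ℝ) (x : ℤ → Ω → κ → ℝ)
    (t : ℤ) (ω : Ω) : ι → ℝ :=
  ∑ k ∈ a.support, (a k).mulVec (x (t + k) ω)

/-- The value `∑ k, a_k e^{ikθ}` of the transfer function of that filter. -/
def firOnCircle {ι κ : Type*} (a : ℤ →₀ Matrix ι κ ℝ) (θ : ℝ) : Matrix ι κ ℂ :=
  ∑ k ∈ a.support, circlePt θ ^ k • (a k).map (fun c : ℝ => (c : ℂ))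

/-- The squared `L²(Φ)` norm `∫ tr (E Φ E*) dθ` of a matrix function `E` on the circle. -/
def specNormSq {ι κ : Type*} [Fintype ι] [Fintype κ] (Φ : Matrix κ κ (RatFunc ℝ))
    (E : ℝ → Matrix ι κ ℂ) : ENNReal :=
  ∫⁻ θ in Set.Ioc (-Real.pi) Real.pi,
    ENNReal.ofReal ((E θ * onCircle Φ θ * (E θ).conjTranspose).trace).re

/-- `s = G(z) x`, that is `s(t) = ∫ e^{itθ} G(e^{iθ}) dx̂`, for a stationary process `x` with
spectral density `Φ`. The stochastic integral is the isometric extension from trigonometric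
polynomials: some finite filters converge to `G` in `L²(Φ)` while their outputs converge to
`s(t)` in `L²(P)` for every `t`. In particular `G` belongs to `L²(Φ)`; neither stability nor
causality of `G` is required. -/
structure IsFilterOutput {Ω ι κ : Type*} [MeasurableSpace Ω] [Fintype ι] [Fintype κ]
    (P : Measure Ω) (x : ℤ → Ω → κ → ℝ) (Φ : Matrix κ κ (RatFunc ℝ))
    (G : Matrix ι κ (RatFunc ℝ)) (s : ℤ → Ω → ι → ℝ) : Prop where
  memLp : ∀ t i, MemLp (fun ω => s t ω i) 2 P
  approx : ∃ a : ℕ → (ℤ →₀ Matrix ι κ ℝ),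
    Tendsto (fun n => specNormSq Φ fun θ => onCircle G θ - firOnCircle (a n) θ) atTop (𝓝 0) ∧
    ∀ t i, Tendsto (fun n => eLpNorm (fun ω => s t ω i - firApply (a n) x t ω i) 2 P)
      atTop (𝓝 0)

/-- A proper rational function: finite at infinity. -/
def IsProperRat (f : RatFunc ℝ) : Prop := f.num.degree ≤ f.denom.degree

/-- A strictly stable transfer function: analytic in the complement of the open unit disc,
infinity included. -/
def IsStrictlyStable (f : RatFunc ℝ) : Prop :=
  IsProperRat f ∧ ∀ z : ℂ, 1 ≤ ‖z‖ → Polynomial.aeval z f.denom ≠ 0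

/-- The matrix `[I, -H; -F, I]` of the loop `u = H y + r`, `y = F u + v`, mapping `(u, y)` to
`(r, v)`. -/
def loopMatrix {ι κ : Type*} [DecidableEq ι] [DecidableEq κ]
    (F : Matrix κ ι (RatFunc ℝ)) (H : Matrix ι κ (RatFunc ℝ)) :
    Matrix (ι ⊕ κ) (ι ⊕ κ) (RatFunc ℝ) :=
  Matrix.fromBlocks 1 (-H) (-F) 1

/-- Internal stability: the loop is well posed and all entries of the closed-loop transfer
function from `(r, v)` to `(u, y)` are strictly stable. -/
def IsInternallyStable {ι κ : Type*} [Fintype ι] [Fintype κ] [DecidableEq ι] [DecidableEq κ]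
    (F : Matrix κ ι (RatFunc ℝ)) (H : Matrix ι κ (RatFunc ℝ)) : Prop :=
  IsUnit (loopMatrix F H).det ∧ ∀ i j, IsStrictlyStable ((loopMatrix F H)⁻¹ i j)

/-- The internally stable feedback model `y = F(z) u`, `u = H(z) y + r` without noise in the
forward channel; `Φu` and `Φy` are the spectral densities of `u` and `y`. -/
structure IsFeedbackModel {Ω ι κ : Type*} [MeasurableSpace Ω] [Fintype ι] [Fintype κ]
    [DecidableEq ι] [DecidableEq κ] (P : Measure Ω)
    (u : ℤ → Ω → ι → ℝ) (y : ℤ → Ω → κ → ℝ)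
    (Φu : Matrix ι ι (RatFunc ℝ)) (Φy : Matrix κ κ (RatFunc ℝ))
    (F : Matrix κ ι (RatFunc ℝ)) (H : Matrix ι κ (RatFunc ℝ)) (r : ℤ → Ω → ι → ℝ) :
    Prop where
  forward : IsFilterOutput P u Φu F y
  feedback : IsFilterOutput P y Φy H (fun t ω i => u t ω i - r t ω i)
  stable : IsInternallyStable F H

/-- The subvector process formed by the components of `x` selected by `f`. -/
def subprocess {Ω ι κ : Type*} (x : ℤ → Ω → ι → ℝ) (f : κ → ι) : ℤ → Ω → κ → ℝ :=
  fun t ω k => x t ω (f k)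

end

/-! Write `K = [F, -I]` and let `~` denote the para-conjugate transpose. The process `F u - y` has
spectral density `K Φ K~`. Since `Φ` is positive semidefinite on the circle, this process vanishes
exactly when `K Φ = 0`. So `y = F(z) u` amounts to a linear identity over the field `RatFunc ℝ`: `F`
times the `u`-rows of `Φ` equals the `y`-rows (`IsFilterOutput.mul_selection_eq`,
`isFilterOutput_of_mul_eq`). Because `rank Φ = rank Φ_u = m`, the Schur complement of `Φ_u`
vanishes, so `Φ_yu Φ_u⁻¹` solves this identity; `Φ_u` is invertible, so no other `F` does. Such an
`F` may have poles on the circle, but it lies in `L²(Φ_u)` because `F Φ_u F~ = Φ_y`.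

The feedback is built over the principal ideal domain of polynomials in `z⁻¹`. Smith normal form
reduces `F` to scalar fractions `n_k / μ_k`, and a Bézout identity `x_k μ_k + y_k n_k = 1` gives the
scalar controllers `-y_k / x_k`. All closed-loop entries are then polynomials in `z⁻¹`, whose only
pole is at `0` (`exists_stabilizing_feedback`). The freedom in the Bézout identity is spent on
making `x_k` nonzero at `z⁻¹ = 0`, so that `H` is proper, and on the unit circle, so that `H` is
bounded there and `H y` exists (`exists_bezout_ne_zero`).

In any such model `r = u - H y` has spectral density `(I - H F) Φ_u (I - H F)~`. The determinant of
`I - H F` is that of the loop, hence all three factors are invertible.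

The analytic base is the isometry between finite filters and trigonometric polynomials, extended to
limits in `IsSpectralRep.integral_mul_eq`. It needs positivity of `Φ` on the circle
(`posSemidef_onCircle`) and the density of finite filters among rational functions of `L²(Φ)`
(`exists_fir_specNormSq_lt`). -/

noncomputable section

/-! ### Values of rational functions on the unit circle. -/

theorem norm_circlePt (θ : ℝ) : ‖circlePt θ‖ = 1 := Complex.norm_exp_ofReal_mul_I θ

theorem circlePt_ne_zero (θ : ℝ) : circlePt θ ≠ 0 := Complex.exp_ne_zero _

theorem continuous_circlePt : Continuous circlePt := by unfold circlePt; fun_prop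

theorem conj_circlePt (θ : ℝ) : (starRingEnd ℂ) (circlePt θ) = (circlePt θ)⁻¹ := by
  rw [Complex.inv_def, Complex.normSq_eq_norm_sq, norm_circlePt]; simp

theorem exists_circlePt_eq {z : ℂ} (hz : ‖z‖ = 1) :
    ∃ θ ∈ Set.Icc (-Real.pi) Real.pi, circlePt θ = z := by
  refine ⟨z.arg, ⟨(Complex.neg_pi_lt_arg z).le, Complex.arg_le_pi z⟩, ?_⟩
  have := Complex.norm_mul_exp_arg_mul_I z
  rwa [hz, Complex.ofReal_one, one_mul] at this

theorem ae_circlePt_ne (z : ℂ) : ∀ᵐ θ : ℝ, circlePt θ ≠ z := by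
  have h : {θ : ℝ | circlePt θ = z}.Countable := by
    by_cases hne : ∃ θ₀, circlePt θ₀ = z
    · obtain ⟨θ₀, h₀⟩ := hne
      refine (Set.countable_range fun n : ℤ => θ₀ + n * (2 * Real.pi)).mono ?_
      intro θ hθ
      have h1 : circlePt θ = circlePt θ₀ := by rw [h₀]; exact hθ
      obtain ⟨n, hn⟩ := Complex.exp_eq_exp_iff_exists_int.1 h1
      refine ⟨n, ?_⟩
      have h2 : (θ : ℂ) = θ₀ + n * (2 * Real.pi) := by
        apply mul_right_cancel₀ Complex.I_ne_zero
        rw [hn]; ring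
      exact_mod_cast h2.symm
    · convert Set.countable_empty
      ext θ; simp only [Set.mem_ofPred_eq, Set.mem_empty_iff_false, iff_false]
      exact fun h => hne ⟨θ, h⟩
  simpa using h.ae_notMem volume

/-- Value of a rational function at a point of the circle. -/
def ratValue (f : RatFunc ℝ) (θ : ℝ) : ℂ := f.eval (algebraMap ℝ ℂ) (circlePt θ)

theorem onCircle_apply {ι κ : Type*} (G : Matrix ι κ (RatFunc ℝ)) (θ : ℝ) (i : ι) (j : κ) :
    onCircle G θ i j = ratValue (G i j) θ := rfl

theorem ratValue_eq_div (f : RatFunc ℝ) (θ : ℝ) :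
    ratValue f θ = Polynomial.aeval (circlePt θ) f.num / Polynomial.aeval (circlePt θ) f.denom :=
  rfl

theorem ae_aeval_ne_zero {d : Polynomial ℝ} (hd : d ≠ 0) :
    ∀ᵐ θ : ℝ, Polynomial.aeval (circlePt θ) d ≠ 0 := by
  have hfin : (d.rootSet ℂ).Finite := Polynomial.rootSet_finite d ℂ
  have h : ∀ᵐ θ : ℝ, ∀ z ∈ d.rootSet ℂ, circlePt θ ≠ z :=
    (ae_ball_iff hfin.countable).2 fun z _ => ae_circlePt_ne z
  filter_upwards [h] with θ hθ h0
  exact hθ _ (Polynomial.mem_rootSet.2 ⟨hd, h0⟩) rfl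

theorem ae_denom_ne_zero (f : RatFunc ℝ) :
    ∀ᵐ θ : ℝ, Polynomial.aeval (circlePt θ) f.denom ≠ 0 := ae_aeval_ne_zero f.denom_ne_zero

/-- `RatFunc.eval` takes the default value `0` at a pole, so algebraic identities survive evaluation
only off the poles. This is why all such statements hold almost everywhere. -/
theorem ratValue_mul (f g : RatFunc ℝ) :
    ∀ᵐ θ : ℝ, ratValue (f * g) θ = ratValue f θ * ratValue g θ := by
  filter_upwards [ae_denom_ne_zero f, ae_denom_ne_zero g] with θ hf hg
  exact RatFunc.eval_mul _ _ hf hg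

theorem ratValue_add (f g : RatFunc ℝ) :
    ∀ᵐ θ : ℝ, ratValue (f + g) θ = ratValue f θ + ratValue g θ := by
  filter_upwards [ae_denom_ne_zero f, ae_denom_ne_zero g] with θ hf hg
  exact RatFunc.eval_add _ _ hf hg

theorem ratValue_zero (θ : ℝ) : ratValue 0 θ = 0 := by simp [ratValue]

theorem ratValue_one (θ : ℝ) : ratValue 1 θ = 1 := by simp [ratValue]

theorem ratValue_neg (f : RatFunc ℝ) : ∀ᵐ θ : ℝ, ratValue (-f) θ = -ratValue f θ := by
  filter_upwards [ratValue_mul (-1) f, ratValue_add (-1) 1] with θ h1 h2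
  have h3 : ratValue (-1) θ = -1 := by
    rw [neg_add_cancel, ratValue_zero, ratValue_one] at h2
    linear_combination -h2
  rw [← neg_one_mul, h1, h3, neg_one_mul]

theorem ratValue_sum {α : Type*} (s : Finset α) (f : α → RatFunc ℝ) :
    ∀ᵐ θ : ℝ, ratValue (∑ i ∈ s, f i) θ = ∑ i ∈ s, ratValue (f i) θ := by
  classical
  induction s using Finset.induction_on with
  | empty => simp [ratValue_zero]
  | insert a s ha ih =>
    filter_upwards [ih, ratValue_add (f a) (∑ i ∈ s, f i)] with θ h1 h2
    rw [Finset.sum_insert ha, Finset.sum_insert ha, h2, h1]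

theorem onCircle_mul {ι κ ν : Type*} [Finite ι] [Fintype κ] [Finite ν]
    (A : Matrix ι κ (RatFunc ℝ)) (B : Matrix κ ν (RatFunc ℝ)) :
    ∀ᵐ θ : ℝ, onCircle (A * B) θ = onCircle A θ * onCircle B θ := by
  have h : ∀ᵐ θ : ℝ, ∀ i j, ratValue ((A * B) i j) θ = ∑ k, ratValue (A i k * B k j) θ :=
    ae_all_iff.2 fun i => ae_all_iff.2 fun j => ratValue_sum _ _
  have h' : ∀ᵐ θ : ℝ, ∀ i j k, ratValue (A i k * B k j) θ
      = ratValue (A i k) θ * ratValue (B k j) θ :=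
    ae_all_iff.2 fun i => ae_all_iff.2 fun j => ae_all_iff.2 fun k => ratValue_mul _ _
  filter_upwards [h, h'] with θ h1 h2
  ext i j
  rw [onCircle_apply, h1]
  simp only [h2, Matrix.mul_apply, onCircle_apply]

theorem onCircle_add {ι κ : Type*} [Finite ι] [Finite κ] (A B : Matrix ι κ (RatFunc ℝ)) :
    ∀ᵐ θ : ℝ, onCircle (A + B) θ = onCircle A θ + onCircle B θ := by
  have h : ∀ᵐ θ : ℝ, ∀ i j, ratValue ((A + B) i j) θ = ratValue (A i j) θ + ratValue (B i j) θ :=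
    ae_all_iff.2 fun i => ae_all_iff.2 fun j => ratValue_add _ _
  filter_upwards [h] with θ h1
  ext i j
  rw [onCircle_apply, h1]; rfl

theorem onCircle_neg {ι κ : Type*} [Finite ι] [Finite κ] (A : Matrix ι κ (RatFunc ℝ)) :
    ∀ᵐ θ : ℝ, onCircle (-A) θ = -onCircle A θ := by
  have h : ∀ᵐ θ : ℝ, ∀ i j, ratValue ((-A) i j) θ = -ratValue (A i j) θ :=
    ae_all_iff.2 fun i => ae_all_iff.2 fun j => ratValue_neg _
  filter_upwards [h] with θ h1
  ext i j
  rw [onCircle_apply, h1]; rfl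

theorem onCircle_sub {ι κ : Type*} [Finite ι] [Finite κ] (A B : Matrix ι κ (RatFunc ℝ)) :
    ∀ᵐ θ : ℝ, onCircle (A - B) θ = onCircle A θ - onCircle B θ := by
  filter_upwards [onCircle_add A (-B), onCircle_neg B] with θ h1 h2
  rw [sub_eq_add_neg, h1, h2, sub_eq_add_neg]

theorem onCircle_one {ι : Type*} [DecidableEq ι] (θ : ℝ) :
    onCircle (1 : Matrix ι ι (RatFunc ℝ)) θ = 1 := by
  ext i j
  by_cases h : i = j
  · subst h; simp [onCircle_apply, ratValue_one]
  · simp [onCircle_apply, ratValue_zero, Matrix.one_apply_ne h]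

/-- The route back from almost-everywhere identities on the circle to identities over `RatFunc ℝ`: a
nonzero numerator has only finitely many zeros. -/
theorem eq_zero_of_ratValue_ae_zero {f : RatFunc ℝ}
    (h : ∀ᵐ θ ∂(volume.restrict (Set.Ioc (-Real.pi) Real.pi)), ratValue f θ = 0) : f = 0 := by
  by_contra hf
  have hn : f.num ≠ 0 := RatFunc.num_ne_zero hf
  have h1 : ∀ᵐ θ ∂(volume.restrict (Set.Ioc (-Real.pi) Real.pi)), False := by
    filter_upwards [h, ae_restrict_of_ae (ae_aeval_ne_zero hn),
      ae_restrict_of_ae (ae_denom_ne_zero f)] with θ h0 h1 h2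
    rw [ratValue_eq_div, div_eq_zero_iff] at h0
    tauto
  have h2 : volume (Set.Ioc (-Real.pi) Real.pi) = 0 := by
    rw [ae_iff] at h1
    simpa using h1
  rw [Real.volume_Ioc] at h2
  have := Real.pi_pos
  simp only [ENNReal.ofReal_eq_zero] at h2
  linarith

theorem eq_zero_of_onCircle_ae_zero {ι κ : Type*} {A : Matrix ι κ (RatFunc ℝ)}
    (h : ∀ᵐ θ ∂(volume.restrict (Set.Ioc (-Real.pi) Real.pi)), onCircle A θ = 0) : A = 0 := by
  ext i j
  exact eq_zero_of_ratValue_ae_zero (h.mono fun θ hθ => by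
    rw [← onCircle_apply, hθ, Matrix.zero_apply])

/-! The substitution `z ↦ z⁻¹`. -/

/-- A polynomial evaluated at `z⁻¹`. -/
def polyInv : Polynomial ℝ →ₐ[ℝ] RatFunc ℝ := Polynomial.aeval (RatFunc.X⁻¹ : RatFunc ℝ)

theorem polyInv_reflect (N : ℕ) (p : Polynomial ℝ) (hp : p.natDegree ≤ N) :
    polyInv p * RatFunc.X ^ N = algebraMap _ _ (Polynomial.reflect N p) := by
  let _ : Invertible (RatFunc.X : RatFunc ℝ) := invertibleOfNonzero RatFunc.X_ne_zero
  have hX : (RatFunc.X : RatFunc ℝ) ≠ 0 := RatFunc.X_ne_zero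
  let _ : Invertible (RatFunc.X⁻¹ : RatFunc ℝ) := invertibleOfNonzero (inv_ne_zero hX)
  have h := Polynomial.eval₂_reflect_mul_pow (algebraMap ℝ (RatFunc ℝ)) (RatFunc.X⁻¹) N p hp
  have h2 : polyInv p = Polynomial.eval₂ (algebraMap ℝ (RatFunc ℝ)) (RatFunc.X⁻¹) p := rfl
  rw [h2, ← h, mul_assoc, ← mul_pow, inv_mul_cancel₀ hX, one_pow, mul_one]
  rw [← RatFunc.aeval_X_left_eq_algebraMap, Polynomial.aeval_def]
  congr 1
  rw [invOf_eq_inv, inv_inv]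

theorem polyInv_injective : Function.Injective polyInv := by
  rw [injective_iff_map_eq_zero]
  intro p hp
  have h := polyInv_reflect _ p le_rfl
  rw [hp, zero_mul] at h
  have := (RatFunc.algebraMap_injective ℝ) (h.symm.trans (map_zero _).symm)
  exact Polynomial.reflect_eq_zero_iff.1 this

theorem polyInv_ne_zero {p : Polynomial ℝ} (hp : p ≠ 0) : polyInv p ≠ 0 :=
  (map_ne_zero_iff _ polyInv_injective).2 hp

/-- The para-conjugate `f(z⁻¹)` of a rational function `f`. -/
def paraConj : RatFunc ℝ →ₐ[ℝ] RatFunc ℝ :=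
  RatFunc.liftAlgHom polyInv
    (nonZeroDivisors_le_comap_nonZeroDivisors_of_injective _ polyInv_injective)

theorem paraConj_algebraMap (p : Polynomial ℝ) : paraConj (algebraMap _ _ p) = polyInv p := by
  have h := RatFunc.liftAlgHom_apply_div (φ := polyInv)
    (nonZeroDivisors_le_comap_nonZeroDivisors_of_injective _ polyInv_injective) p 1
  simpa [paraConj] using h

theorem paraConj_X : paraConj RatFunc.X = RatFunc.X⁻¹ := by
  rw [← RatFunc.algebraMap_X, paraConj_algebraMap]; simp [polyInv]

theorem paraConj_polyInv (p : Polynomial ℝ) : paraConj (polyInv p) = algebraMap _ _ p := by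
  rw [polyInv, ← Polynomial.aeval_algHom_apply, map_inv₀, paraConj_X, inv_inv,
    RatFunc.aeval_X_left_eq_algebraMap]

theorem paraConj_paraConj (f : RatFunc ℝ) : paraConj (paraConj f) = f := by
  conv_rhs => rw [← RatFunc.num_div_denom f]
  conv_lhs => rw [← RatFunc.num_div_denom f]
  rw [map_div₀, map_div₀, paraConj_algebraMap, paraConj_algebraMap, paraConj_polyInv,
    paraConj_polyInv]

/-- The involution `z ↦ z⁻¹` carries the reduced fraction of `paraConj f` to a coprime fraction in
`z⁻¹`, as the Bézout construction requires. -/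
theorem exists_coprime_polyInv_div (f : RatFunc ℝ) :
    ∃ n d : Polynomial ℝ, d ≠ 0 ∧ IsCoprime n d ∧ f = polyInv n / polyInv d := by
  refine ⟨(paraConj f).num, (paraConj f).denom, RatFunc.denom_ne_zero _,
    RatFunc.isCoprime_num_denom _, ?_⟩
  rw [← paraConj_algebraMap, ← paraConj_algebraMap, ← map_div₀, RatFunc.num_div_denom,
    paraConj_paraConj]

theorem conj_aeval (p : Polynomial ℝ) (z : ℂ) :
    (starRingEnd ℂ) (Polynomial.aeval z p) = Polynomial.aeval ((starRingEnd ℂ) z) p := by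
  exact (Polynomial.aeval_algHom_apply Complex.conjAe.toAlgHom z p).symm

theorem ratValue_div_algebraMap (A B : Polynomial ℝ) (θ : ℝ)
    (hB : Polynomial.aeval (circlePt θ) B ≠ 0) :
    ratValue (algebraMap _ _ A / algebraMap _ _ B) θ
      = Polynomial.aeval (circlePt θ) A / Polynomial.aeval (circlePt θ) B := by
  have hB0 : B ≠ 0 := by rintro rfl; simp at hB
  set f : RatFunc ℝ := algebraMap _ _ A / algebraMap _ _ B with hf
  have h : f.num * B = A * f.denom := (RatFunc.num_mul_eq_mul_denom_iff hB0).2 hf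
  have hd : Polynomial.aeval (circlePt θ) f.denom ≠ 0 := by
    obtain ⟨c, hc⟩ := (RatFunc.denom_dvd hB0).2 ⟨A, hf⟩
    rw [hc, map_mul] at hB
    exact left_ne_zero_of_mul hB
  rw [ratValue_eq_div, div_eq_div_iff hd hB, ← map_mul, ← map_mul, h]

theorem aeval_reflect_eq (N : ℕ) (p : Polynomial ℝ) (hp : p.natDegree ≤ N) {z : ℂ}
    (hz : z ≠ 0) :
    Polynomial.aeval z (Polynomial.reflect N p) = z ^ N * Polynomial.aeval z⁻¹ p := by
  let _ : Invertible z⁻¹ := invertibleOfNonzero (inv_ne_zero hz)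
  have h := Polynomial.eval₂_reflect_mul_pow (algebraMap ℝ ℂ) z⁻¹ N p hp
  rw [invOf_eq_inv, inv_inv] at h
  rw [Polynomial.aeval_def, Polynomial.aeval_def, ← h, mul_comm, mul_assoc, ← mul_pow,
    inv_mul_cancel₀ hz, one_pow, mul_one]

/-- On the circle `z⁻¹` is the conjugate of `z`, and the coefficients are real. -/
theorem ratValue_paraConj (f : RatFunc ℝ) :
    ∀ᵐ θ : ℝ, ratValue (paraConj f) θ = (starRingEnd ℂ) (ratValue f θ) := by
  set N := max f.num.natDegree f.denom.natDegree
  have hX : (RatFunc.X : RatFunc ℝ) ≠ 0 := RatFunc.X_ne_zero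
  have h : paraConj f = algebraMap _ _ (Polynomial.reflect N f.num)
      / algebraMap _ _ (Polynomial.reflect N f.denom) := by
    conv_lhs => rw [← RatFunc.num_div_denom f]
    rw [map_div₀, paraConj_algebraMap, paraConj_algebraMap,
      ← polyInv_reflect N f.num (le_max_left _ _), ← polyInv_reflect N f.denom (le_max_right _ _),
      mul_div_mul_right _ _ (pow_ne_zero _ hX)]
  filter_upwards [ae_denom_ne_zero f] with θ hθ
  have hz := circlePt_ne_zero θ
  have hc : Polynomial.aeval (circlePt θ)⁻¹ f.denom ≠ 0 := by
    rw [← conj_circlePt, ← conj_aeval]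
    exact (map_ne_zero _).2 hθ
  rw [h, ratValue_div_algebraMap, aeval_reflect_eq N _ (le_max_left _ _) hz,
    aeval_reflect_eq N _ (le_max_right _ _) hz, mul_div_mul_left _ _ (pow_ne_zero _ hz),
    ratValue_eq_div, map_div₀, conj_aeval, conj_aeval, conj_circlePt]
  rw [aeval_reflect_eq N _ (le_max_right _ _) hz]
  exact mul_ne_zero (pow_ne_zero _ hz) hc

theorem onCircle_paraConj {ι κ : Type*} [Finite ι] [Finite κ] (A : Matrix ι κ (RatFunc ℝ)) :
    ∀ᵐ θ : ℝ, onCircle (A.map paraConj).transpose θ = (onCircle A θ).conjTranspose := by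
  have h : ∀ᵐ θ : ℝ, ∀ i j, ratValue (paraConj (A i j)) θ = (starRingEnd ℂ) (ratValue (A i j) θ) :=
    ae_all_iff.2 fun i => ae_all_iff.2 fun j => ratValue_paraConj _
  filter_upwards [h] with θ h1
  ext i j
  simp only [onCircle_apply, Matrix.transpose_apply, Matrix.map_apply, h1,
    Matrix.conjTranspose_apply, starRingEnd_apply]

theorem measurable_ratValue (f : RatFunc ℝ) : Measurable (ratValue f) := by
  have h (p : Polynomial ℝ) : Continuous fun θ => Polynomial.aeval (circlePt θ) p :=
    p.continuous_aeval.comp continuous_circlePt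
  exact ((h f.num).measurable).div (h f.denom).measurable

theorem continuous_ratValue {f : RatFunc ℝ}
    (hf : ∀ z : ℂ, ‖z‖ = 1 → Polynomial.aeval z f.denom ≠ 0) : Continuous (ratValue f) := by
  have h (p : Polynomial ℝ) : Continuous fun θ => Polynomial.aeval (circlePt θ) p :=
    p.continuous_aeval.comp continuous_circlePt
  exact (h f.num).div (h f.denom) fun θ => hf _ (norm_circlePt θ)

/-- A rational function that is integrable on the circle has no poles there. -/
theorem denom_ne_zero_of_integrable {f : RatFunc ℝ}
    (hf : IntervalIntegrable (ratValue f) volume (-Real.pi) Real.pi) (z : ℂ) (hz : ‖z‖ = 1) :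
    Polynomial.aeval z f.denom ≠ 0 := by
  intro h0
  obtain ⟨c, hc, hcz⟩ := exists_circlePt_eq hz
  rw [← Set.uIcc_of_le (by linarith [Real.pi_pos])] at hc
  refine not_intervalIntegrable_of_sub_inv_isBigO_punctured (c := c) ?_
    (by linarith [Real.pi_pos]) hc hf
  have hn : Polynomial.aeval z f.num ≠ 0 := by
    obtain ⟨a, b, hab⟩ := RatFunc.isCoprime_num_denom f
    intro hn
    have := congrArg (Polynomial.aeval z) hab
    simp [hn, h0] at this
  have hcont (p : Polynomial ℝ) : Continuous fun θ => Polynomial.aeval (circlePt θ) p :=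
    p.continuous_aeval.comp continuous_circlePt
  -- The reciprocal of `f`. It is differentiable and zero at the pole `c`, hence `O(θ - c)`; so `(θ
  -- - c)⁻¹ = O(f)`, which is not integrable.
  set g : ℝ → ℂ := fun θ =>
    Polynomial.aeval (circlePt θ) f.denom / Polynomial.aeval (circlePt θ) f.num with hg
  have hgd : DifferentiableAt ℝ g c := by
    have hd (p : Polynomial ℝ) : DifferentiableAt ℝ (fun θ => Polynomial.aeval (circlePt θ) p) c := by
      have h1 : DifferentiableAt ℝ circlePt c := by
        have : DifferentiableAt ℝ (fun θ : ℝ => (θ : ℂ) * Complex.I) c :=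
          (Complex.ofRealCLM.differentiableAt).mul_const _
        exact this.cexp
      have h2 : DifferentiableAt ℂ (fun w : ℂ => Polynomial.aeval w p) (circlePt c) := by
        have := (p.map (algebraMap ℝ ℂ)).differentiable (circlePt c)
        simpa [Polynomial.aeval_def, Polynomial.eval_map] using this
      exact (h2.restrictScalars ℝ).comp c h1
    exact (hd _).fun_div (hd _) (by rw [hcz]; exact hn)
  have hgc : g c = 0 := by simp [hg, hcz, h0]
  have h1 : g =O[𝓝 c] fun θ => θ - c := by
    have := hgd.isBigO_sub
    simpa [hgc] using this
  have h2 : (ratValue f) = fun θ => (g θ)⁻¹ := by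
    ext θ; simp [hg, ratValue_eq_div]
  rw [h2]
  -- Inverting the estimate requires `g ≠ 0` near `c`: `circlePt` has nonzero derivative, so it
  -- avoids the finitely many roots of the denominator on a punctured neighbourhood.
  have h3 : ∀ᶠ θ in 𝓝[≠] c, g θ = 0 → θ - c = 0 := by
    have hne : ∀ᶠ θ in 𝓝[≠] c, Polynomial.aeval (circlePt θ) f.denom ≠ 0 := by
      have hd : HasDerivAt circlePt (Complex.exp ((c : ℂ) * Complex.I) * (1 * Complex.I)) c :=
        ((Complex.ofRealCLM.hasDerivAt (x := c)).mul_const Complex.I).cexp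
      have hw : ∀ᶠ θ in 𝓝[≠] c, ∀ w ∈ f.denom.rootSet ℂ, circlePt θ ≠ w :=
        (Filter.eventually_all_finite (Polynomial.rootSet_finite _ ℂ)).2 fun w _ =>
          hd.eventually_ne (mul_ne_zero (Complex.exp_ne_zero _) (by simp))
      filter_upwards [hw] with θ hθ h0
      exact hθ _ (Polynomial.mem_rootSet.2 ⟨f.denom_ne_zero, h0⟩) rfl
    have hne' : ∀ᶠ θ in 𝓝[≠] c, Polynomial.aeval (circlePt θ) f.num ≠ 0 := by
      refine ((hcont f.num).continuousAt.eventually_ne ?_).filter_mono nhdsWithin_le_nhds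
      rw [hcz]; exact hn
    filter_upwards [hne, hne'] with θ h1 h2 h3
    rw [hg] at h3
    simp only [div_eq_zero_iff] at h3
    tauto
  exact (h1.mono nhdsWithin_le_nhds).inv_rev h3

/-! Uniform approximation on the circle by trigonometric polynomials. -/

theorem exists_trigPoly_approx {g : ℂ → ℂ} (hg : ContinuousOn g (Metric.sphere 0 1)) {ε : ℝ}
    (hε : 0 < ε) : ∃ c : ℤ →₀ ℂ, ∀ θ : ℝ,
      ‖g (circlePt θ) - ∑ k ∈ c.support, c k * circlePt θ ^ k‖ < ε := by
  have : Fact (0 < 2 * Real.pi) := ⟨Real.two_pi_pos⟩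
  let F : C(AddCircle (2 * Real.pi), ℂ) :=
    ⟨fun x => g (AddCircle.toCircle x : ℂ), by
      refine hg.comp_continuous (continuous_subtype_val.comp AddCircle.continuous_toCircle) ?_
      intro x; simpa using Circle.norm_coe _⟩
  have hF : F ∈ (Submodule.span ℂ (Set.range (@fourier (2 * Real.pi)))).topologicalClosure := by
    rw [span_fourier_closure_eq_top]; trivial
  obtain ⟨G, hG, hGF⟩ := Metric.mem_closure_iff.1 hF ε hε
  obtain ⟨c, hc⟩ := (Finsupp.mem_span_range_iff_exists_finsupp).1 hG
  refine ⟨c, fun θ => ?_⟩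
  have h1 := (ContinuousMap.dist_lt_iff hε).1 hGF (θ : AddCircle (2 * Real.pi))
  have h2 : (AddCircle.toCircle (θ : AddCircle (2 * Real.pi)) : ℂ) = circlePt θ := by
    rw [AddCircle.toCircle_apply_mk, Circle.coe_exp, circlePt]
    congr 2
    field_simp [Real.pi_ne_zero]
  have h3 : G (θ : AddCircle (2 * Real.pi)) = ∑ k ∈ c.support, c k * circlePt θ ^ k := by
    rw [← hc, Finsupp.sum, ContinuousMap.sum_apply]
    refine Finset.sum_congr rfl fun k _ => ?_
    rw [ContinuousMap.smul_apply, smul_eq_mul, fourier_coe_apply, circlePt, ← Complex.exp_int_mul]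
    congr 2
    push_cast
    field_simp [Complex.ofReal_ne_zero.2 Real.pi_ne_zero]
  rw [dist_eq_norm, h3] at h1
  simpa [F, h2] using h1

/-- By the symmetry of `g`, conjugating the coefficients of an approximant gives another one of the
same quality. The average of the two has the real parts as coefficients. -/
theorem exists_real_trigPoly_approx {g : ℂ → ℂ} (hg : ContinuousOn g (Metric.sphere 0 1))
    (hsymm : ∀ z, ‖z‖ = 1 → g ((starRingEnd ℂ) z) = (starRingEnd ℂ) (g z)) {ε : ℝ}
    (hε : 0 < ε) : ∃ c : ℤ →₀ ℝ, ∀ θ : ℝ,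
      ‖g (circlePt θ) - ∑ k ∈ c.support, (c k : ℂ) * circlePt θ ^ k‖ < ε := by
  obtain ⟨c, hc⟩ := exists_trigPoly_approx hg hε
  refine ⟨c.mapRange Complex.re Complex.zero_re, fun θ => ?_⟩
  have h0 : ∑ k ∈ (c.mapRange Complex.re Complex.zero_re).support,
      ((c.mapRange Complex.re Complex.zero_re k : ℝ) : ℂ) * circlePt θ ^ k
      = ∑ k ∈ c.support, ((c k).re : ℂ) * circlePt θ ^ k := by
    simp only [Finsupp.mapRange_apply]
    refine Finset.sum_subset Finsupp.support_mapRange fun k _ hk => ?_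
    rw [Finsupp.notMem_support_iff, Finsupp.mapRange_apply] at hk
    rw [hk]; simp
  have hneg : circlePt (-θ) = (starRingEnd ℂ) (circlePt θ) := by
    rw [conj_circlePt, circlePt, circlePt, ← Complex.exp_neg]; push_cast; ring_nf
  have h1 := hc θ
  have h2 := hc (-θ)
  rw [hneg, hsymm _ (norm_circlePt θ), ← Complex.norm_conj] at h2
  simp only [map_sub, map_sum, map_mul, map_zpow₀, Complex.conj_conj] at h2
  rw [h0]
  have h3 : g (circlePt θ) - ∑ k ∈ c.support, ((c k).re : ℂ) * circlePt θ ^ k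
      = (1 / 2 : ℂ) * ((g (circlePt θ) - ∑ k ∈ c.support, c k * circlePt θ ^ k)
        + (g (circlePt θ) - ∑ k ∈ c.support, (starRingEnd ℂ) (c k) * circlePt θ ^ k)) := by
    have : ∑ k ∈ c.support, ((c k).re : ℂ) * circlePt θ ^ k
        = (1 / 2 : ℂ) * (∑ k ∈ c.support, c k * circlePt θ ^ k
          + ∑ k ∈ c.support, (starRingEnd ℂ) (c k) * circlePt θ ^ k) := by
      rw [← Finset.sum_add_distrib, Finset.mul_sum]
      refine Finset.sum_congr rfl fun k _ => ?_
      rw [Complex.re_eq_add_conj]; ring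
    rw [this]; ring
  rw [h3, norm_mul]
  have h4 := norm_add_le (g (circlePt θ) - ∑ k ∈ c.support, c k * circlePt θ ^ k)
    (g (circlePt θ) - ∑ k ∈ c.support, (starRingEnd ℂ) (c k) * circlePt θ ^ k)
  have h5 : ‖(1 / 2 : ℂ)‖ = 1 / 2 := by norm_num
  rw [h5]; linarith

/-! Algebra of finite impulse responses. -/

theorem firOnCircle_apply {ι κ : Type*} (a : ℤ →₀ Matrix ι κ ℝ) {S : Finset ℤ}
    (hS : a.support ⊆ S) (θ : ℝ) (i : ι) (j : κ) :
    firOnCircle a θ i j = ∑ k ∈ S, circlePt θ ^ k * (a k i j : ℂ) := by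
  rw [firOnCircle, Matrix.sum_apply]
  simp only [Matrix.smul_apply, Matrix.map_apply, smul_eq_mul]
  refine Finset.sum_subset hS fun k _ hk => ?_
  rw [Finsupp.notMem_support_iff] at hk
  simp [hk]

theorem firApply_apply {Ω ι κ : Type*} [Fintype κ] (a : ℤ →₀ Matrix ι κ ℝ) {S : Finset ℤ}
    (hS : a.support ⊆ S) (x : ℤ → Ω → κ → ℝ) (t : ℤ) (ω : Ω) (i : ι) :
    firApply a x t ω i = ∑ k ∈ S, ∑ j, a k i j * x (t + k) ω j := by
  rw [firApply, Finset.sum_apply]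
  simp only [Matrix.mulVec, dotProduct]
  refine Finset.sum_subset hS fun k _ hk => ?_
  rw [Finsupp.notMem_support_iff] at hk
  simp [hk]

theorem firOnCircle_sub {ι κ : Type*} (a b : ℤ →₀ Matrix ι κ ℝ) (θ : ℝ) :
    firOnCircle (a - b) θ = firOnCircle a θ - firOnCircle b θ := by
  classical
  ext i j
  rw [Matrix.sub_apply, firOnCircle_apply _ (S := a.support ∪ b.support) Finsupp.support_sub,
    firOnCircle_apply a Finset.subset_union_left, firOnCircle_apply b Finset.subset_union_right,
    ← Finset.sum_sub_distrib]
  refine Finset.sum_congr rfl fun k _ => ?_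
  simp; ring

theorem firApply_sub {Ω ι κ : Type*} [Fintype κ] (a b : ℤ →₀ Matrix ι κ ℝ)
    (x : ℤ → Ω → κ → ℝ) (t : ℤ) (ω : Ω) :
    firApply (a - b) x t ω = firApply a x t ω - firApply b x t ω := by
  classical
  ext i
  rw [Pi.sub_apply, firApply_apply _ (S := a.support ∪ b.support) Finsupp.support_sub,
    firApply_apply a Finset.subset_union_left, firApply_apply b Finset.subset_union_right,
    ← Finset.sum_sub_distrib]
  refine Finset.sum_congr rfl fun k _ => ?_
  rw [← Finset.sum_sub_distrib]
  refine Finset.sum_congr rfl fun j _ => ?_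
  simp; ring

theorem continuous_firOnCircle {ι κ : Type*} (a : ℤ →₀ Matrix ι κ ℝ) (i : ι) (j : κ) :
    Continuous fun θ => firOnCircle a θ i j := by
  simp only [firOnCircle_apply a (Finset.Subset.refl _)]
  refine continuous_finsetSum _ fun k _ => ?_
  exact (continuous_circlePt.zpow₀ k fun θ => Or.inl (circlePt_ne_zero θ)).mul continuous_const

/-- The filter with a single coefficient `M` at time `0`. -/
theorem firOnCircle_single {ι κ : Type*} (M : Matrix ι κ ℝ) (θ : ℝ) :
    firOnCircle (Finsupp.single 0 M) θ = M.map (fun c : ℝ => (c : ℂ)) := by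
  ext i j
  rw [firOnCircle_apply _ Finsupp.support_single_subset]
  simp

theorem firApply_single {Ω ι κ : Type*} [Fintype κ] (M : Matrix ι κ ℝ)
    (x : ℤ → Ω → κ → ℝ) (t : ℤ) (ω : Ω) :
    firApply (Finsupp.single 0 M) x t ω = M.mulVec (x t ω) := by
  ext i
  rw [firApply_apply _ Finsupp.support_single_subset]
  simp [Matrix.mulVec, dotProduct]

theorem firOnCircle_mapRange_mul {ι κ ν : Type*} [Fintype κ] (a : ℤ →₀ Matrix ι κ ℝ)
    (S : Matrix κ ν ℝ) (θ : ℝ) :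
    firOnCircle (a.mapRange (· * S) (Matrix.zero_mul S)) θ
      = firOnCircle a θ * S.map (fun c : ℝ => (c : ℂ)) := by
  ext i j
  rw [firOnCircle_apply _ Finsupp.support_mapRange, Matrix.mul_apply]
  simp only [firOnCircle_apply a (Finset.Subset.refl _), Finset.sum_mul]
  rw [Finset.sum_comm]
  refine Finset.sum_congr rfl fun k _ => ?_
  simp [Matrix.mul_apply, Finset.mul_sum, mul_assoc]

theorem firApply_mapRange_mul {Ω ι κ ν : Type*} [Fintype κ] [Fintype ν] (a : ℤ →₀ Matrix ι κ ℝ)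
    (S : Matrix κ ν ℝ) (x : ℤ → Ω → ν → ℝ) (t : ℤ) (ω : Ω) :
    firApply (a.mapRange (· * S) (Matrix.zero_mul S)) x t ω
      = firApply a (fun t ω => S.mulVec (x t ω)) t ω := by
  ext i
  rw [firApply_apply _ Finsupp.support_mapRange, firApply_apply a (Finset.Subset.refl _)]
  refine Finset.sum_congr rfl fun k _ => ?_
  simp only [Finsupp.mapRange_apply, Matrix.mul_apply, Matrix.mulVec, dotProduct,
    Finset.sum_mul, Finset.mul_sum]
  rw [Finset.sum_comm]
  simp only [mul_assoc]

theorem exists_fir_approx {ι κ : Type*} [Fintype ι] [Fintype κ] {g : ι → κ → ℂ → ℂ}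
    (hg : ∀ i j, ContinuousOn (g i j) (Metric.sphere 0 1))
    (hsymm : ∀ i j z, ‖z‖ = 1 → g i j ((starRingEnd ℂ) z) = (starRingEnd ℂ) (g i j z))
    {ε : ℝ} (hε : 0 < ε) : ∃ a : ℤ →₀ Matrix ι κ ℝ, ∀ (θ : ℝ) i j,
      ‖g i j (circlePt θ) - firOnCircle a θ i j‖ < ε := by
  classical
  choose c hc using fun i j => exists_real_trigPoly_approx (hg i j) (hsymm i j) hε
  let S : Finset ℤ := Finset.univ.biUnion fun i => Finset.univ.biUnion fun j => (c i j).support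
  have hS (i j) : (c i j).support ⊆ S := fun k hk => by
    simp only [S, Finset.mem_biUnion, Finset.mem_univ, true_and]
    exact ⟨i, j, hk⟩
  let a : ℤ →₀ Matrix ι κ ℝ := Finsupp.onFinset S (fun k => Matrix.of fun i j => c i j k) (by
    intro k hk
    by_contra hkS
    apply hk
    ext i j
    exact Finsupp.notMem_support_iff.1 fun h => hkS (hS i j h))
  refine ⟨a, fun θ i j => ?_⟩
  rw [firOnCircle_apply a Finsupp.support_onFinset_subset]
  convert hc i j θ using 3
  symm
  have : ∀ k, circlePt θ ^ k * (a k i j : ℂ) = (c i j k : ℂ) * circlePt θ ^ k := fun k => by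
    rw [mul_comm]; rfl
  simp only [this]
  refine Finset.sum_subset (hS i j) fun k _ hk => ?_
  rw [Finsupp.notMem_support_iff.1 hk]; simp

/-! The isometry between finite filters of a process and trigonometric polynomials, and
positivity of the spectral density. -/

section
variable {Ω κ : Type*} [MeasurableSpace Ω] {P : Measure Ω}
  {x : ℤ → Ω → κ → ℝ} {Φ : Matrix κ κ (RatFunc ℝ)}

theorem continuous_onCircle (hΦ : IsSpectralDensity P x Φ) (i j : κ) :
    Continuous fun θ => onCircle Φ θ i j :=
  continuous_ratValue (hΦ.no_pole i j)

variable [Fintype κ]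

theorem memLp_firApply (hx : IsWideSenseStationary P x) {ι : Type*} (a : ℤ →₀ Matrix ι κ ℝ)
    (t : ℤ) (i : ι) : MemLp (fun ω => firApply a x t ω i) 2 P := by
  simp only [firApply_apply a (Finset.Subset.refl _)]
  exact memLp_finsetSum _ fun k _ => memLp_finsetSum _ fun j _ =>
    (hx.memLp (t + k) j).const_mul _

theorem integral_firApply [IsFiniteMeasure P] (hx : IsWideSenseStationary P x) {ι : Type*}
    (a : ℤ →₀ Matrix ι κ ℝ) (t : ℤ) (i : ι) : ∫ ω, firApply a x t ω i ∂P = 0 := by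
  have hint (k : ℤ) (j : κ) : Integrable (fun ω => a k i j * x (t + k) ω j) P :=
    ((hx.memLp (t + k) j).integrable one_le_two).const_mul _
  simp only [firApply_apply a (Finset.Subset.refl _)]
  rw [integral_finsetSum _ fun k _ => integrable_finsetSum _ fun j _ => hint k j]
  refine Finset.sum_eq_zero fun k _ => ?_
  rw [integral_finsetSum _ fun j _ => hint k j]
  refine Finset.sum_eq_zero fun j _ => ?_
  rw [integral_const_mul, hx.mean_zero, mul_zero]

theorem mul_mul_conjTranspose_apply {ι ι' : Type*} (A : Matrix ι κ ℂ) (M : Matrix κ κ ℂ)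
    (B : Matrix ι' κ ℂ) (i : ι) (j : ι') :
    (A * M * B.conjTranspose) i j = ∑ c, ∑ d, A i c * M c d * (starRingEnd ℂ) (B j d) := by
  simp only [Matrix.mul_apply, Matrix.conjTranspose_apply, Finset.sum_mul, starRingEnd_apply]
  rw [Finset.sum_comm]

theorem zpow_mul_fir_form {ι ι' : Type*} (a : ℤ →₀ Matrix ι κ ℝ) (b : ℤ →₀ Matrix ι' κ ℝ)
    (M : Matrix κ κ ℂ) (θ : ℝ) (k : ℤ) (i : ι) (j : ι') :
    circlePt θ ^ k * (firOnCircle a θ * M * (firOnCircle b θ).conjTranspose) i j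
      = ∑ p ∈ a.support ×ˢ Finset.univ, ∑ q ∈ b.support ×ˢ Finset.univ,
          ((a p.1 i p.2 * b q.1 j q.2 : ℝ) : ℂ) * (circlePt θ ^ (k + p.1 - q.1) * M p.2 q.2) := by
  have hz := circlePt_ne_zero θ
  rw [mul_mul_conjTranspose_apply]
  simp only [firOnCircle_apply _ (Finset.Subset.refl _), Finset.sum_product, map_sum, map_mul,
    map_zpow₀, conj_circlePt, Complex.conj_ofReal, Finset.mul_sum, Finset.sum_mul]
  symm
  refine Eq.trans Finset.sum_comm (Finset.sum_congr rfl fun c _ => ?_)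
  refine Eq.trans (Finset.sum_congr rfl fun p _ => Finset.sum_comm) ?_
  refine Eq.trans Finset.sum_comm (Finset.sum_congr rfl fun d _ => ?_)
  refine Eq.trans Finset.sum_comm (Finset.sum_congr rfl fun q _ =>
    Finset.sum_congr rfl fun p _ => ?_)
  rw [zpow_sub₀ hz, zpow_add₀ hz, inv_zpow]
  push_cast
  field_simp

/-- Both sides are bilinear in the filter coefficients, and the pair of coefficients at `p` and `q`
contributes the covariance at lag `k + p - q`. -/
theorem integral_firApply_mul (hx : IsWideSenseStationary P x) (hΦ : IsSpectralDensity P x Φ)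
    {ι ι' : Type*} (a : ℤ →₀ Matrix ι κ ℝ) (b : ℤ →₀ Matrix ι' κ ℝ) (t k : ℤ) (i : ι) (j : ι') :
    ((∫ ω, firApply a x (t + k) ω i * firApply b x t ω j ∂P : ℝ) : ℂ)
      = (2 * (Real.pi : ℂ))⁻¹ * ∫ θ in (-Real.pi)..Real.pi, circlePt θ ^ k *
        (firOnCircle a θ * onCircle Φ θ * (firOnCircle b θ).conjTranspose) i j := by
  simp only [zpow_mul_fir_form]
  have hcont (n : ℤ) (c d : κ) (r : ℂ) :
      Continuous fun θ => r * (circlePt θ ^ n * onCircle Φ θ c d) :=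
    continuous_const.mul ((continuous_circlePt.zpow₀ n fun θ => Or.inl (circlePt_ne_zero θ)).mul
      (continuous_onCircle hΦ c d))
  rw [intervalIntegral.integral_finsetSum fun p _ => by
    refine Continuous.intervalIntegrable (continuous_finsetSum _ fun q _ => hcont _ _ _ _) _ _]
  simp only [intervalIntegral.integral_finsetSum fun q _ =>
    (hcont _ _ _ _).intervalIntegrable _ _, intervalIntegral.integral_const_mul]
  have hexp : (fun ω => firApply a x (t + k) ω i * firApply b x t ω j)
      = fun ω => ∑ p ∈ a.support ×ˢ (Finset.univ : Finset κ),
        ∑ q ∈ b.support ×ˢ (Finset.univ : Finset κ), (a p.1 i p.2 * b q.1 j q.2)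
          * (x (t + k + p.1) ω p.2 * x (t + q.1) ω q.2) := by
    ext ω
    rw [firApply_apply a (Finset.Subset.refl _), firApply_apply b (Finset.Subset.refl _),
      Finset.sum_mul_sum]
    simp only [Finset.sum_product, Finset.sum_mul_sum]
    refine Finset.sum_congr rfl fun p _ => Eq.trans Finset.sum_comm ?_
    refine Finset.sum_congr rfl fun c _ => Finset.sum_congr rfl fun q _ =>
      Finset.sum_congr rfl fun d _ => by ring
  have hint (p q : ℤ × κ) : Integrable (fun ω => (a p.1 i p.2 * b q.1 j q.2)
          * (x (t + k + p.1) ω p.2 * x (t + q.1) ω q.2)) P :=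
    ((hx.memLp _ _).integrable_mul (hx.memLp _ _)).const_mul _
  rw [hexp, integral_finsetSum _ fun p _ => integrable_finsetSum _ fun q _ => hint p q,
    Complex.ofReal_sum, Finset.mul_sum]
  refine Finset.sum_congr rfl fun p _ => ?_
  rw [integral_finsetSum _ fun q _ => hint p q, Complex.ofReal_sum, Finset.mul_sum]
  refine Finset.sum_congr rfl fun q _ => ?_
  have h := hΦ.cov_eq (t + q.1) (k + p.1 - q.1) p.2 q.2
  have ht : t + q.1 + (k + p.1 - q.1) = t + k + p.1 := by ring
  rw [ht] at h
  rw [integral_const_mul, Complex.ofReal_mul, h]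
  ring

/-- The trigonometric polynomial `∑ φ_k e^{ikθ}`. -/
def trigPoly (φ : ℤ →₀ ℂ) (θ : ℝ) : ℂ := ∑ k ∈ φ.support, φ k * circlePt θ ^ k

open scoped ComplexOrder in
-- The filters are real, so `φ v` is split as `α + iβ`. The two cross terms cancel after integration
-- because real covariances commute, and what remains is `2π` times the sum of the second moments of
-- the outputs of `α` and `β`.
theorem integral_trigPoly_nonneg (hx : IsWideSenseStationary P x) (hΦ : IsSpectralDensity P x Φ)
    (φ : ℤ →₀ ℂ) (v : κ → ℂ) :
    0 ≤ ∫ θ in (-Real.pi)..Real.pi, (Complex.normSq (trigPoly φ θ) : ℂ) *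
      (v ⬝ᵥ (onCircle Φ θ).mulVec (star v)) := by
  let α : ℤ →₀ Matrix Unit κ ℝ := Finsupp.onFinset φ.support
    (fun k => Matrix.of fun _ j => (φ k * v j).re) (fun k hk => by
      rw [Finsupp.mem_support_iff]; rintro h; apply hk; ext; simp [h])
  let β : ℤ →₀ Matrix Unit κ ℝ := Finsupp.onFinset φ.support
    (fun k => Matrix.of fun _ j => (φ k * v j).im) (fun k hk => by
      rw [Finsupp.mem_support_iff]; rintro h; apply hk; ext; simp [h])
  have hE (θ : ℝ) (j : κ) : trigPoly φ θ * v j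
      = firOnCircle α θ () j + Complex.I * firOnCircle β θ () j := by
    rw [firOnCircle_apply α Finsupp.support_onFinset_subset,
      firOnCircle_apply β Finsupp.support_onFinset_subset, trigPoly, Finset.sum_mul,
      Finset.mul_sum, ← Finset.sum_add_distrib]
    refine Finset.sum_congr rfl fun k _ => ?_
    have : φ k * v j = (α k () j : ℂ) + (β k () j : ℂ) * Complex.I :=
      (Complex.re_add_im _).symm
    linear_combination circlePt θ ^ k * this
  let Q (a b : ℤ →₀ Matrix Unit κ ℝ) (θ : ℝ) : ℂ :=
    (firOnCircle a θ * onCircle Φ θ * (firOnCircle b θ).conjTranspose) () ()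
  have hQ (a b : ℤ →₀ Matrix Unit κ ℝ) : ∫ θ in (-Real.pi)..Real.pi, Q a b θ
      = 2 * (Real.pi : ℂ) * ((∫ ω, firApply a x 0 ω () * firApply b x 0 ω () ∂P : ℝ) : ℂ) := by
    have h := integral_firApply_mul hx hΦ a b 0 0 () ()
    simp only [zpow_zero, one_mul, add_zero] at h
    rw [h, mul_inv_cancel_left₀]
    exact mul_ne_zero two_ne_zero (Complex.ofReal_ne_zero.2 Real.pi_ne_zero)
  have hQc (a b : ℤ →₀ Matrix Unit κ ℝ) : Continuous (Q a b) := by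
    simp only [Q, mul_mul_conjTranspose_apply]
    refine continuous_finsetSum _ fun c _ => continuous_finsetSum _ fun d _ => ?_
    exact ((continuous_firOnCircle a _ _).mul (continuous_onCircle hΦ c d)).mul
      (Complex.continuous_conj.comp (continuous_firOnCircle b _ _))
  have hpt (θ : ℝ) : (Complex.normSq (trigPoly φ θ) : ℂ) *
      (v ⬝ᵥ (onCircle Φ θ).mulVec (star v))
      = Q α α θ + Q β β θ + Complex.I * (Q β α θ - Q α β θ) := by
    simp only [Q, mul_mul_conjTranspose_apply, dotProduct, Matrix.mulVec, Finset.mul_sum,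
      ← Finset.sum_add_distrib, ← Finset.sum_sub_distrib]
    refine Finset.sum_congr rfl fun c _ => Finset.sum_congr rfl fun d _ => ?_
    have h1 := hE θ c
    have h2 := congrArg (starRingEnd ℂ) (hE θ d)
    simp only [map_mul, map_add, Complex.conj_I] at h2
    rw [← Complex.mul_conj, Pi.star_apply, ← starRingEnd_apply]
    calc _ = (trigPoly φ θ * v c) * onCircle Φ θ c d *
          ((starRingEnd ℂ) (trigPoly φ θ) * (starRingEnd ℂ) (v d)) := by ring
      _ = _ := by
        rw [h1, h2]
        ring_nf
        rw [Complex.I_sq]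
        ring
  have hi (a b : ℤ →₀ Matrix Unit κ ℝ) :
      IntervalIntegrable (Q a b) volume (-Real.pi) Real.pi := (hQc a b).intervalIntegrable _ _
  simp only [hpt]
  rw [intervalIntegral.integral_add ((hi _ _).add (hi _ _)) (((hi _ _).sub (hi _ _)).const_mul _),
    intervalIntegral.integral_add (hi _ _) (hi _ _), intervalIntegral.integral_const_mul,
    intervalIntegral.integral_sub (hi _ _) (hi _ _), hQ, hQ, hQ, hQ]
  have hcomm : ∫ ω, firApply β x 0 ω () * firApply α x 0 ω () ∂P
      = ∫ ω, firApply α x 0 ω () * firApply β x 0 ω () ∂P := by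
    simp only [mul_comm]
  rw [hcomm, sub_self, mul_zero, add_zero, ← mul_add, ← Complex.ofReal_add]
  have h0 (a : ℤ →₀ Matrix Unit κ ℝ) :
      0 ≤ ∫ ω, firApply a x 0 ω () * firApply a x 0 ω () ∂P :=
    integral_nonneg fun ω => mul_self_nonneg _
  have hpi := Real.pi_pos
  have := mul_nonneg (mul_nonneg zero_le_two hpi.le) (add_nonneg (h0 α) (h0 β))
  exact_mod_cast Complex.zero_le_real.2 this

open scoped ComplexOrder in
theorem nonneg_of_integral_trigPoly_nonneg {f : ℂ → ℂ} (hf : ContinuousOn f (Metric.sphere 0 1))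
    (h : ∀ φ : ℤ →₀ ℂ, 0 ≤ ∫ θ in (-Real.pi)..Real.pi,
      (Complex.normSq (trigPoly φ θ) : ℂ) * f (circlePt θ)) :
    ∀ θ, 0 ≤ f (circlePt θ) := by
  have hcirc {g : ℂ → ℂ} (hg : ContinuousOn g (Metric.sphere 0 1)) :
      Continuous fun θ => g (circlePt θ) :=
    hg.comp_continuous continuous_circlePt fun θ => by simp [norm_circlePt]
  have htp (φ : ℤ →₀ ℂ) : Continuous (trigPoly φ) := by
    unfold trigPoly
    exact continuous_finsetSum _ fun k _ => continuous_const.mul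
      (continuous_circlePt.zpow₀ k fun θ => Or.inl (circlePt_ne_zero θ))
  -- Uniform approximation extends the hypothesis from trigonometric polynomials to all continuous
  -- test functions `g`.
  have key (g : ℂ → ℂ) (hg : ContinuousOn g (Metric.sphere 0 1)) :
      0 ≤ ∫ θ in (-Real.pi)..Real.pi,
        (Complex.normSq (g (circlePt θ)) : ℂ) * f (circlePt θ) := by
    choose φ hφ using fun n : ℕ => exists_trigPoly_approx hg (Nat.one_div_pos_of_nat (n := n))
    have hlim (θ : ℝ) : Tendsto (fun n => trigPoly (φ n) θ) atTop (𝓝 (g (circlePt θ))) := by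
      rw [tendsto_iff_norm_sub_tendsto_zero]
      refine squeeze_zero (fun _ => norm_nonneg _) (fun n => ?_)
        tendsto_one_div_add_atTop_nhds_zero_nat
      rw [norm_sub_rev]
      exact (hφ n θ).le
    refine ge_of_tendsto (x := atTop) (f := fun n : ℕ => ∫ θ in (-Real.pi)..Real.pi,
      (Complex.normSq (trigPoly (φ n) θ) : ℂ) * f (circlePt θ)) ?_
      (Eventually.of_forall fun n => h (φ n))
    refine intervalIntegral.tendsto_integral_filter_of_dominated_convergence
      (fun θ => (‖g (circlePt θ)‖ + 1) ^ 2 * ‖f (circlePt θ)‖) ?_ ?_ ?_ ?_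
    · refine Eventually.of_forall fun n => Continuous.aestronglyMeasurable ?_
      exact (Complex.continuous_ofReal.comp (Complex.continuous_normSq.comp (htp _))).mul (hcirc hf)
    · refine Eventually.of_forall fun n => ae_of_all _ fun θ _ => ?_
      rw [norm_mul, Complex.norm_real, Complex.normSq_eq_norm_sq, norm_pow, norm_norm]
      gcongr
      have h1 : ‖g (circlePt θ) - trigPoly (φ n) θ‖ < 1 / ((n : ℝ) + 1) := hφ n θ
      have h2 : 1 / ((n : ℝ) + 1) ≤ 1 := by
        rw [div_le_one (by positivity)]; linarith [(Nat.cast_nonneg n : (0 : ℝ) ≤ n)]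
      have h3 := norm_sub_norm_le (trigPoly (φ n) θ) (g (circlePt θ))
      rw [norm_sub_rev] at h3
      linarith
    · exact Continuous.intervalIntegrable
        ((((hcirc hg).norm.add continuous_const).pow 2).mul (hcirc hf).norm) _ _
    · refine ae_of_all _ fun θ _ => Tendsto.mul_const _ ?_
      exact (Complex.continuous_ofReal.tendsto _).comp
        ((Complex.continuous_normSq.tendsto _).comp (hlim θ))
  -- If `L (f)` were positive somewhere, the test function `g = √(max (L f) 0)` would give a
  -- nonnegative integral on which `L` takes the value `∫ max (L f) 0 * L f > 0`.
  have hL (L : ℂ →L[ℝ] ℝ) (hL : ∀ w : ℂ, 0 ≤ w → L w ≤ 0) (θ : ℝ) : L (f (circlePt θ)) ≤ 0 := by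
    by_contra! hpos
    obtain ⟨θ₀, hθ₀, heq⟩ := exists_circlePt_eq (norm_circlePt θ)
    rw [← heq] at hpos
    have hlf : ContinuousOn (fun z => max (L (f z)) 0) (Metric.sphere 0 1) :=
      (continuous_id.max continuous_const : Continuous fun r : ℝ => max r 0).comp_continuousOn
        (L.continuous.comp_continuousOn hf)
    have hg : ContinuousOn (fun z => ((Real.sqrt (max (L (f z)) 0) : ℝ) : ℂ))
      (Metric.sphere 0 1) := Complex.continuous_ofReal.comp_continuousOn hlf.sqrt
    have h1 := hL _ (key _ hg)
    have h2 (θ : ℝ) : (Complex.normSq ((Real.sqrt (max (L (f (circlePt θ))) 0) : ℝ) : ℂ) : ℂ)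
        * f (circlePt θ) = (max (L (f (circlePt θ))) 0) • f (circlePt θ) := by
      rw [Complex.normSq_ofReal, Real.mul_self_sqrt (le_max_right _ _), Complex.real_smul]
    simp only [h2] at h1
    have hcl : Continuous fun θ => L (f (circlePt θ)) := L.continuous.comp (hcirc hf)
    have hc3 : Continuous fun θ => max (L (f (circlePt θ))) 0 := hcl.max continuous_const
    have hii : IntervalIntegrable (fun θ => (max (L (f (circlePt θ))) 0) • f (circlePt θ)) volume
      (-Real.pi) Real.pi := (hc3.smul (hcirc hf)).intervalIntegrable _ _
    rw [← L.intervalIntegral_comp_comm hii] at h1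
    simp only [map_smul, smul_eq_mul] at h1
    refine absurd h1 (not_le.2 ?_)
    refine intervalIntegral.integral_pos (by linarith [Real.pi_pos]) (hc3.mul hcl).continuousOn
      (fun θ _ => ?_) ⟨θ₀, hθ₀, ?_⟩
    · rcases le_total (L (f (circlePt θ))) 0 with h | h
      · rw [max_eq_right h, zero_mul]
      · rw [max_eq_left h]; exact mul_self_nonneg _
    · rw [max_eq_left hpos.le]; positivity
  intro θ
  -- In the order on `ℂ`, `0 ≤ w` means nonnegative real part and zero imaginary part; the three
  -- functionals `-re`, `im`, `-im` test exactly this.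
  have h1 := hL (-Complex.reCLM) (fun w hw => by simpa using (Complex.le_def.1 hw).1) θ
  have h2 := hL Complex.imCLM (fun w hw => by simpa using (Complex.le_def.1 hw).2.symm.le) θ
  have h3 := hL (-Complex.imCLM) (fun w hw => by simpa using (Complex.le_def.1 hw).2.le) θ
  simp only [_root_.neg_apply, Complex.reCLM_apply, Complex.imCLM_apply] at h1 h2 h3
  rw [Complex.le_def]
  simp only [Complex.zero_re, Complex.zero_im]
  constructor <;> linarith

open scoped ComplexOrder in
-- Over `ℂ` a quadratic form with real values forces the matrix to be Hermitian, so no symmetry has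
-- to be assumed.
theorem Matrix.posSemidef_of_nonneg {M : Matrix κ κ ℂ}
    (h : ∀ v : κ → ℂ, 0 ≤ v ⬝ᵥ M.mulVec (star v)) : M.PosSemidef := by
  classical
  rw [← Matrix.isPositive_toEuclideanLin_iff, LinearMap.isPositive_iff_complex]
  intro w
  have h1 := h (star w.ofLp)
  have h2 : inner ℂ (M.toEuclideanLin w) w = star (star w.ofLp ⬝ᵥ M.mulVec w.ofLp) := by
    rw [EuclideanSpace.inner_eq_star_dotProduct, ← Matrix.star_dotProduct_star, star_star,
      dotProduct_comm]
    rfl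
  rw [star_star] at h1
  obtain ⟨hre, him⟩ := Complex.le_def.1 h1
  rw [h2]
  constructor
  · apply Complex.ext
    · simp
    · simpa using him.symm
  · simpa using hre

open scoped ComplexOrder in
theorem posSemidef_onCircle (hx : IsWideSenseStationary P x) (hΦ : IsSpectralDensity P x Φ)
    (θ : ℝ) : (onCircle Φ θ).PosSemidef := by
  refine Matrix.posSemidef_of_nonneg fun v => ?_
  refine nonneg_of_integral_trigPoly_nonneg (f := fun z => v ⬝ᵥ Matrix.mulVec
    (Φ.map fun f => f.eval (algebraMap ℝ ℂ) z) (star v)) ?_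
    (fun φ => integral_trigPoly_nonneg hx hΦ φ v) θ
  simp only [dotProduct, Matrix.mulVec]
  refine continuousOn_finsetSum _ fun c _ => continuousOn_const.mul ?_
  refine continuousOn_finsetSum _ fun d _ => ContinuousOn.mul ?_ continuousOn_const
  exact ((Φ c d).num.continuous_aeval.continuousOn).div ((Φ c d).denom.continuous_aeval.continuousOn)
    fun z hz => hΦ.no_pole c d z (by simpa using hz)
end

/-! The pointwise quadratic form `tr (A M A*)` of a positive semidefinite matrix. -/

/-- `tr (A M A*)`. -/
def traceForm {ι κ : Type*} [Fintype ι] [Fintype κ] (M : Matrix κ κ ℂ) (A : Matrix ι κ ℂ) : ℝ :=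
  (A * M * A.conjTranspose).trace.re

section
open scoped ComplexOrder MatrixOrder Matrix
variable {ι ι' κ : Type*} [Fintype ι] [Fintype ι'] [Fintype κ]
  {M : Matrix κ κ ℂ}

theorem Matrix.PosSemidef.exists_factor (hM : M.PosSemidef) :
    ∃ C : Matrix κ κ ℂ, M = C * Cᴴ := by
  classical
  exact CStarAlgebra.nonneg_iff_eq_mul_star_self.1 hM.nonneg

/-- With `M = C C*` the form is the squared Frobenius norm of `A C`. The estimates for semidefinite
`M` below reduce to this. -/
theorem traceForm_factor (C : Matrix κ κ ℂ) (A : Matrix ι κ ℂ) :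
    traceForm (C * Cᴴ) A = ∑ i, ∑ j, ‖(A * C) i j‖ ^ 2 := by
  have h : A * (C * Cᴴ) * Aᴴ = (A * C) * (A * C)ᴴ := by
    rw [Matrix.conjTranspose_mul]; simp only [Matrix.mul_assoc]
  rw [traceForm, h, Matrix.trace, Complex.re_sum]
  refine Finset.sum_congr rfl fun i _ => ?_
  rw [Matrix.diag_apply, Matrix.mul_apply, Complex.re_sum]
  refine Finset.sum_congr rfl fun j _ => ?_
  rw [Matrix.conjTranspose_apply, ← starRingEnd_apply, Complex.mul_conj, Complex.ofReal_re,
    Complex.normSq_eq_norm_sq]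

theorem traceForm_nonneg (hM : M.PosSemidef) (A : Matrix ι κ ℂ) : 0 ≤ traceForm M A := by
  obtain ⟨C, rfl⟩ := hM.exists_factor
  rw [traceForm_factor]
  positivity

theorem traceForm_add_le (hM : M.PosSemidef) (A B : Matrix ι κ ℂ) :
    traceForm M (A + B) ≤ 2 * traceForm M A + 2 * traceForm M B := by
  obtain ⟨C, rfl⟩ := hM.exists_factor
  simp only [traceForm_factor, Finset.mul_sum, ← Finset.sum_add_distrib]
  refine Finset.sum_le_sum fun i _ => Finset.sum_le_sum fun j _ => ?_
  rw [Matrix.add_mul, Matrix.add_apply]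
  have h1 := norm_add_le ((A * C) i j) ((B * C) i j)
  have h2 := norm_nonneg ((A * C) i j + (B * C) i j)
  nlinarith [sq_nonneg (‖(A * C) i j‖ - ‖(B * C) i j‖)]

theorem traceForm_neg (M : Matrix κ κ ℂ) (A : Matrix ι κ ℂ) :
    traceForm M (-A) = traceForm M A := by
  simp [traceForm]

theorem traceForm_sub_le (hM : M.PosSemidef) (A B : Matrix ι κ ℂ) :
    traceForm M (A - B) ≤ 2 * traceForm M A + 2 * traceForm M B := by
  rw [sub_eq_add_neg, ← traceForm_neg M B]
  exact traceForm_add_le hM A (-B)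

theorem traceForm_smul (M : Matrix κ κ ℂ) (r : ℝ) (A : Matrix ι κ ℂ) :
    traceForm M ((r : ℂ) • A) = r ^ 2 * traceForm M A := by
  simp only [traceForm, Matrix.conjTranspose_smul, Matrix.smul_mul, Matrix.mul_smul,
    Matrix.trace_smul, smul_eq_mul, Complex.star_def, Complex.conj_ofReal, ← mul_assoc,
    ← Complex.ofReal_mul, Complex.re_ofReal_mul]
  ring

/-- Cauchy–Schwarz for the rows of `A C` and `B C`, each bounded by the full Frobenius norm. -/
theorem norm_entry_le (hM : M.PosSemidef) (A : Matrix ι κ ℂ) (B : Matrix ι' κ ℂ) (i : ι)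
    (j : ι') : ‖(A * M * Bᴴ) i j‖ ≤ Real.sqrt (traceForm M A) * Real.sqrt (traceForm M B) := by
  obtain ⟨C, rfl⟩ := hM.exists_factor
  have h : A * (C * Cᴴ) * Bᴴ = (A * C) * (B * C)ᴴ := by
    rw [Matrix.conjTranspose_mul]; simp only [Matrix.mul_assoc]
  rw [h, Matrix.mul_apply, traceForm_factor, traceForm_factor]
  calc ‖∑ k, (A * C) i k * (B * C)ᴴ k j‖ ≤ ∑ k, ‖(A * C) i k‖ * ‖(B * C) j k‖ := by
        refine (norm_sum_le _ _).trans (Finset.sum_le_sum fun k _ => ?_)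
        rw [norm_mul, Matrix.conjTranspose_apply, norm_star]
    _ ≤ Real.sqrt (∑ k, ‖(A * C) i k‖ ^ 2) * Real.sqrt (∑ k, ‖(B * C) j k‖ ^ 2) :=
        Real.sum_mul_le_sqrt_mul_sqrt _ _ _
    _ ≤ _ := by
        gcongr
        · exact Finset.single_le_sum (f := fun i => ∑ k, ‖(A * C) i k‖ ^ 2)
            (fun i _ => by positivity) (Finset.mem_univ i)
        · exact Finset.single_le_sum (f := fun j => ∑ k, ‖(B * C) j k‖ ^ 2)
            (fun i _ => by positivity) (Finset.mem_univ j)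

theorem mul_eq_zero_of_traceForm (hM : M.PosSemidef) {A : Matrix ι κ ℂ}
    (h : traceForm M A = 0) : A * M = 0 := by
  obtain ⟨C, rfl⟩ := hM.exists_factor
  rw [traceForm_factor] at h
  have h1 : A * C = 0 := by
    ext i j
    have h2 := (Finset.sum_eq_zero_iff_of_nonneg fun i _ => by positivity).1 h i (Finset.mem_univ _)
    have h3 := (Finset.sum_eq_zero_iff_of_nonneg fun i _ => by positivity).1 h2 j
      (Finset.mem_univ _)
    simpa using h3
  rw [← Matrix.mul_assoc, h1, Matrix.zero_mul]

theorem traceForm_le_of_bounded (A : Matrix ι κ ℂ) {c : ℝ} (hA : ∀ i j, ‖A i j‖ ≤ c) :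
    traceForm M A ≤ Fintype.card ι * (c ^ 2 * ∑ j, ∑ k, ‖M j k‖) := by
  have h : ∀ i, ((A * M * Aᴴ) i i).re ≤ c ^ 2 * ∑ j, ∑ k, ‖M j k‖ := fun i => by
    rw [mul_mul_conjTranspose_apply]
    refine (Complex.re_le_norm _).trans ((norm_sum_le _ _).trans ?_)
    rw [Finset.mul_sum]
    refine Finset.sum_le_sum fun j _ => (norm_sum_le _ _).trans ?_
    rw [Finset.mul_sum]
    refine Finset.sum_le_sum fun k _ => ?_
    rw [norm_mul, norm_mul, Complex.norm_conj]
    calc ‖A i j‖ * ‖M j k‖ * ‖A i k‖ ≤ c * ‖M j k‖ * c := by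
          have hc : 0 ≤ c := (norm_nonneg _).trans (hA i j)
          gcongr <;> exact hA _ _
      _ = _ := by ring
  rw [traceForm, Matrix.trace, Complex.re_sum]
  refine (Finset.sum_le_sum fun i _ => h i).trans ?_
  simp

end

/-! The space `L²(Φ)`. -/

theorem specNormSq_eq {ι κ : Type*} [Fintype ι] [Fintype κ] (Φ : Matrix κ κ (RatFunc ℝ))
    (E : ℝ → Matrix ι κ ℂ) : specNormSq Φ E =
      ∫⁻ θ in Set.Ioc (-Real.pi) Real.pi, ENNReal.ofReal (traceForm (onCircle Φ θ) (E θ)) := rfl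

open scoped ComplexOrder in
/-- `Φ` is positive semidefinite at all points of the circle. -/
def PosOnCircle {κ : Type*} [Fintype κ] (Φ : Matrix κ κ (RatFunc ℝ)) : Prop :=
  ∀ θ, (onCircle Φ θ).PosSemidef

theorem specNormSq_eq_sqrt {ι κ : Type*} [Fintype ι] [Fintype κ] {Φ : Matrix κ κ (RatFunc ℝ)}
    (hpos : PosOnCircle Φ) (E : ℝ → Matrix ι κ ℂ) :
    specNormSq Φ E = ∫⁻ θ in Set.Ioc (-Real.pi) Real.pi,
      (ENNReal.ofReal (Real.sqrt (traceForm (onCircle Φ θ) (E θ)))) ^ (2 : ℝ) := by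
  rw [specNormSq_eq]
  refine lintegral_congr fun θ => ?_
  rw [ENNReal.ofReal_rpow_of_nonneg (Real.sqrt_nonneg _) zero_le_two, Real.rpow_two,
    Real.sq_sqrt (traceForm_nonneg (hpos θ) _)]

/-- Measurability of all entries of a matrix function. -/
def EntryMeasurable {ι κ : Type*} (E : ℝ → Matrix ι κ ℂ) : Prop :=
  ∀ i j, Measurable fun θ => E θ i j

section
variable {ι ι' κ : Type*}

theorem EntryMeasurable.sub {E E' : ℝ → Matrix ι κ ℂ} (h : EntryMeasurable E)
    (h' : EntryMeasurable E') : EntryMeasurable fun θ => E θ - E' θ :=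
  fun i j => (h i j).sub (h' i j)

theorem EntryMeasurable.mul {ν : Type*} [Fintype κ] {E : ℝ → Matrix ι κ ℂ} {E' : ℝ → Matrix κ ν ℂ}
    (h : EntryMeasurable E) (h' : EntryMeasurable E') : EntryMeasurable fun θ => E θ * E' θ := by
  intro i j
  simp only [Matrix.mul_apply]
  exact Finset.measurable_sum _ fun k _ => (h i k).mul (h' k j)

theorem EntryMeasurable.conjTranspose {E : ℝ → Matrix ι κ ℂ} (h : EntryMeasurable E) :
    EntryMeasurable fun θ => (E θ).conjTranspose :=
  fun i j => (Complex.continuous_conj.measurable).comp (h j i)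

theorem entryMeasurable_onCircle (G : Matrix ι κ (RatFunc ℝ)) : EntryMeasurable (onCircle G) :=
  fun i j => measurable_ratValue (G i j)

theorem entryMeasurable_fir (a : ℤ →₀ Matrix ι κ ℝ) : EntryMeasurable (firOnCircle a) :=
  fun i j => (continuous_firOnCircle a i j).measurable

variable [Fintype ι] [Fintype ι'] [Fintype κ] {Φ : Matrix κ κ (RatFunc ℝ)}

theorem measurable_traceForm {E : ℝ → Matrix ι κ ℂ} (h : EntryMeasurable E) :
    Measurable fun θ => traceForm (onCircle Φ θ) (E θ) := by
  have h1 := (h.mul (entryMeasurable_onCircle Φ)).mul h.conjTranspose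
  exact Complex.measurable_re.comp (Finset.measurable_sum _ fun i _ => h1 i i)

theorem specNormSq_congr {E E' : ℝ → Matrix ι κ ℂ}
    (h : ∀ᵐ θ ∂(volume.restrict (Set.Ioc (-Real.pi) Real.pi)), E θ = E' θ) :
    specNormSq Φ E = specNormSq Φ E' :=
  lintegral_congr_ae (h.mono fun θ hθ => by simp only [hθ])

theorem specNormSq_sub_le (hpos : PosOnCircle Φ) {E E' : ℝ → Matrix ι κ ℂ}
    (h : EntryMeasurable E) (h' : EntryMeasurable E') :
    specNormSq Φ (fun θ => E θ - E' θ) ≤ 2 * specNormSq Φ E + 2 * specNormSq Φ E' := by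
  simp only [specNormSq_eq]
  rw [← lintegral_const_mul _ (measurable_traceForm h).ennreal_ofReal,
    ← lintegral_const_mul _ (measurable_traceForm h').ennreal_ofReal,
    ← lintegral_add_left ((measurable_traceForm h).ennreal_ofReal.const_mul _)]
  refine lintegral_mono fun θ => ?_
  refine (ENNReal.ofReal_le_ofReal (traceForm_sub_le (hpos θ) (E θ) (E' θ))).trans_eq ?_
  rw [ENNReal.ofReal_add, ENNReal.ofReal_mul, ENNReal.ofReal_mul] <;>
    simp [traceForm_nonneg (hpos θ)]

theorem specNormSq_sub_comm (E E' : ℝ → Matrix ι κ ℂ) :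
    specNormSq Φ (fun θ => E θ - E' θ) = specNormSq Φ (fun θ => E' θ - E θ) := by
  simp only [specNormSq_eq]
  refine lintegral_congr fun θ => ?_
  rw [← neg_sub, traceForm_neg]

/-- Cauchy–Schwarz in `L²(Φ)`: the pointwise bound `norm_entry_le` followed by Hölder with exponents
`2, 2`. -/
theorem lintegral_entry_le (hpos : PosOnCircle Φ) {A : ℝ → Matrix ι κ ℂ}
    {B : ℝ → Matrix ι' κ ℂ} (hA : EntryMeasurable A) (hB : EntryMeasurable B) (i : ι) (j : ι') :
    ∫⁻ θ in Set.Ioc (-Real.pi) Real.pi,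
      ‖(A θ * onCircle Φ θ * (B θ).conjTranspose) i j‖ₑ
      ≤ specNormSq Φ A ^ (1 / 2 : ℝ) * specNormSq Φ B ^ (1 / 2 : ℝ) := by
  rw [specNormSq_eq_sqrt hpos A, specNormSq_eq_sqrt hpos B]
  refine le_trans (lintegral_mono fun θ => ?_) (ENNReal.lintegral_mul_le_Lp_mul_Lq _
    Real.HolderConjugate.two_two
    (measurable_traceForm hA).sqrt.ennreal_ofReal.aemeasurable
    (measurable_traceForm hB).sqrt.ennreal_ofReal.aemeasurable)
  rw [Pi.mul_apply, ← ENNReal.ofReal_mul (Real.sqrt_nonneg _), ← ofReal_norm]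
  exact ENNReal.ofReal_le_ofReal (norm_entry_le (hpos θ) _ _ i j)

theorem specNormSq_le_of_bounded (hΦ : ∀ i j, Continuous fun θ => onCircle Φ θ i j)
    {E : ℝ → Matrix ι κ ℂ} {c : ℝ} (hE : ∀ θ i j, ‖E θ i j‖ ≤ c) :
    specNormSq Φ E ≤ ENNReal.ofReal (c ^ 2) * ∫⁻ θ in Set.Ioc (-Real.pi) Real.pi,
      ENNReal.ofReal (Fintype.card ι * ∑ j, ∑ k, ‖onCircle Φ θ j k‖) := by
  have hm : Measurable fun θ => (Fintype.card ι * ∑ j, ∑ k, ‖onCircle Φ θ j k‖ : ℝ) :=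
    (continuous_const.mul (continuous_finsetSum _ fun j _ => continuous_finsetSum _ fun k _ =>
      (hΦ j k).norm)).measurable
  rw [← lintegral_const_mul _ hm.ennreal_ofReal, specNormSq_eq]
  refine lintegral_mono fun θ => ?_
  rw [← ENNReal.ofReal_mul (sq_nonneg c)]
  refine ENNReal.ofReal_le_ofReal ((traceForm_le_of_bounded _ (hE θ)).trans_eq ?_)
  ring

theorem lintegral_norm_lt_top (hΦ : ∀ i j, Continuous fun θ => onCircle Φ θ i j) :
    ∫⁻ θ in Set.Ioc (-Real.pi) Real.pi,
      ENNReal.ofReal (Fintype.card ι * ∑ j, ∑ k, ‖onCircle Φ θ j k‖) < ⊤ := by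
  have hc : Continuous fun θ => (Fintype.card ι * ∑ j, ∑ k, ‖onCircle Φ θ j k‖ : ℝ) :=
    continuous_const.mul (continuous_finsetSum _ fun j _ => continuous_finsetSum _ fun k _ =>
      (hΦ j k).norm)
  exact ((hc.integrableOn_Icc).mono_set Set.Ioc_subset_Icc_self).lintegral_lt_top

theorem exists_bound_of_continuous {E : ℝ → Matrix ι κ ℂ}
    (hE : ∀ i j, Continuous fun θ => E θ i j) :
    ∃ c : ℝ, ∀ θ ∈ Set.Icc (-Real.pi) Real.pi, ∀ i j, ‖E θ i j‖ ≤ c := by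
  have hc : Continuous fun θ => ∑ i, ∑ j, ‖E θ i j‖ :=
    continuous_finsetSum _ fun i _ => continuous_finsetSum _ fun j _ => (hE i j).norm
  obtain ⟨c, hc⟩ := (isCompact_Icc (a := -Real.pi) (b := Real.pi)).exists_bound_of_continuousOn
    hc.continuousOn
  refine ⟨c, fun θ hθ i j => ?_⟩
  refine le_trans ?_ ((le_abs_self _).trans (hc θ hθ))
  refine le_trans (Finset.single_le_sum (f := fun j => ‖E θ i j‖) (fun _ _ => norm_nonneg _)
    (Finset.mem_univ j)) ?_
  exact Finset.single_le_sum (f := fun i => ∑ j, ‖E θ i j‖)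
    (fun _ _ => Finset.sum_nonneg fun _ _ => norm_nonneg _) (Finset.mem_univ i)

theorem specNormSq_lt_top_of_continuous (hΦ : ∀ i j, Continuous fun θ => onCircle Φ θ i j)
    {E : ℝ → Matrix ι κ ℂ} (hE : ∀ i j, Continuous fun θ => E θ i j) : specNormSq Φ E < ⊤ := by
  classical
  obtain ⟨c, hc⟩ := exists_bound_of_continuous hE
  -- The norm sees only one period, while `specNormSq_le_of_bounded` asks for a bound at every `θ`;
  -- cutting `E` off outside the interval reconciles them.
  have h : specNormSq Φ E = specNormSq Φ
      ((Set.Icc (-Real.pi) Real.pi).indicator E) := by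
    refine specNormSq_congr ((ae_restrict_mem measurableSet_Ioc).mono fun θ hθ => ?_)
    rw [Set.indicator_of_mem (Set.Ioc_subset_Icc_self hθ)]
  rw [h]
  refine (specNormSq_le_of_bounded hΦ (c := max c 0) fun θ i j => ?_).trans_lt
    (ENNReal.mul_lt_top ENNReal.ofReal_lt_top (lintegral_norm_lt_top hΦ))
  by_cases hθ : θ ∈ Set.Icc (-Real.pi) Real.pi
  · rw [Set.indicator_of_mem hθ]; exact (hc θ hθ i j).trans (le_max_left _ _)
  · rw [Set.indicator_of_notMem hθ]; simp
end

/-! Processes with a spectral representation. -/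

/-- `s(t) = ∫ e^{itθ} E(e^{iθ}) dx̂` for a matrix function `E` that need not be rational. -/
structure IsSpectralRep {Ω ι κ : Type*} [MeasurableSpace Ω] [Fintype ι] [Fintype κ]
    (P : Measure Ω) (x : ℤ → Ω → κ → ℝ) (Φ : Matrix κ κ (RatFunc ℝ))
    (E : ℝ → Matrix ι κ ℂ) (s : ℤ → Ω → ι → ℝ) : Prop where
  entryMeasurable : EntryMeasurable E
  memLp : ∀ t i, MemLp (fun ω => s t ω i) 2 P
  approx : ∃ a : ℕ → (ℤ →₀ Matrix ι κ ℝ),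
    Tendsto (fun n => specNormSq Φ fun θ => E θ - firOnCircle (a n) θ) atTop (𝓝 0) ∧
    ∀ t i, Tendsto (fun n => eLpNorm (fun ω => s t ω i - firApply (a n) x t ω i) 2 P)
      atTop (𝓝 0)

section
variable {Ω ι ι' κ : Type*} [MeasurableSpace Ω] [Fintype ι] [Fintype ι'] [Fintype κ]
  {P : Measure Ω} {x : ℤ → Ω → κ → ℝ} {Φ : Matrix κ κ (RatFunc ℝ)}

theorem IsFilterOutput.isSpectralRep {G : Matrix ι κ (RatFunc ℝ)} {s : ℤ → Ω → ι → ℝ}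
    (h : IsFilterOutput P x Φ G s) : IsSpectralRep P x Φ (onCircle G) s :=
  ⟨entryMeasurable_onCircle G, h.memLp, h.approx⟩

theorem IsSpectralRep.isFilterOutput {G : Matrix ι κ (RatFunc ℝ)} {s : ℤ → Ω → ι → ℝ}
    (h : IsSpectralRep P x Φ (onCircle G) s) : IsFilterOutput P x Φ G s :=
  ⟨h.memLp, h.approx⟩

theorem isSpectralRep_fir (hx : IsWideSenseStationary P x) (a : ℤ →₀ Matrix ι κ ℝ) :
    IsSpectralRep P x Φ (firOnCircle a) (firApply a x) where
  entryMeasurable := entryMeasurable_fir a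
  memLp t i := memLp_firApply hx a t i
  approx := ⟨fun _ => a, by simp [specNormSq], by simp⟩

theorem IsSpectralRep.congr {E E' : ℝ → Matrix ι κ ℂ} {s s' : ℤ → Ω → ι → ℝ}
    (h : IsSpectralRep P x Φ E s) (hE' : EntryMeasurable E')
    (hE : ∀ᵐ θ ∂(volume.restrict (Set.Ioc (-Real.pi) Real.pi)), E θ = E' θ)
    (hs : ∀ t i, (fun ω => s t ω i) =ᵐ[P] fun ω => s' t ω i) : IsSpectralRep P x Φ E' s' := by
  obtain ⟨a, ha, ha'⟩ := h.approx
  refine ⟨hE', fun t i => (h.memLp t i).ae_eq (hs t i), a, ?_, fun t i => ?_⟩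
  · refine ha.congr fun n => specNormSq_congr (hE.mono fun θ hθ => ?_)
    rw [hθ]
  · refine (ha' t i).congr fun n => eLpNorm_congr_ae ((hs t i).mono fun ω hω => ?_)
    simp only at hω ⊢
    rw [hω]

theorem IsSpectralRep.sub (hx : IsWideSenseStationary P x) (hpos : PosOnCircle Φ)
    {E E' : ℝ → Matrix ι κ ℂ}
    {s s' : ℤ → Ω → ι → ℝ} (h : IsSpectralRep P x Φ E s) (h' : IsSpectralRep P x Φ E' s') :
    IsSpectralRep P x Φ (fun θ => E θ - E' θ) (fun t ω i => s t ω i - s' t ω i) := by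
  obtain ⟨a, ha, haP⟩ := h.approx
  obtain ⟨b, hb, hbP⟩ := h'.approx
  refine ⟨h.entryMeasurable.sub h'.entryMeasurable, fun t i => (h.memLp t i).sub (h'.memLp t i),
    fun n => a n - b n, ?_, fun t i => ?_⟩
  · refine tendsto_of_tendsto_of_tendsto_of_le_of_le tendsto_const_nhds
      (h := fun n => 2 * specNormSq Φ (fun θ => E θ - firOnCircle (a n) θ)
        + 2 * specNormSq Φ (fun θ => E' θ - firOnCircle (b n) θ)) ?_ (fun _ => zero_le) fun n => ?_
    · simpa using (ENNReal.Tendsto.const_mul ha (Or.inr ENNReal.ofNat_ne_top)).add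
        (ENNReal.Tendsto.const_mul hb (Or.inr ENNReal.ofNat_ne_top))
    · refine le_trans (le_of_eq ?_) (specNormSq_sub_le hpos
        (h.entryMeasurable.sub (entryMeasurable_fir (a n)))
        (h'.entryMeasurable.sub (entryMeasurable_fir (b n))))
      congr 1; ext θ : 1
      rw [firOnCircle_sub]; abel
  · refine tendsto_of_tendsto_of_tendsto_of_le_of_le tendsto_const_nhds
      (by simpa using (haP t i).add (hbP t i)) (fun _ => zero_le) fun n => ?_
    refine le_trans (le_of_eq ?_) (eLpNorm_sub_le
      ((h.memLp t i).sub (memLp_firApply hx (a n) t i)).aestronglyMeasurable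
      ((h'.memLp t i).sub (memLp_firApply hx (b n) t i)).aestronglyMeasurable one_le_two)
    congr 1; ext ω
    simp only [firApply_sub, Pi.sub_apply]; ring

theorem specNormSq_lt_top_of_approx (hΦ : ∀ i j, Continuous fun θ => onCircle Φ θ i j)
    (hpos : PosOnCircle Φ) {E : ℝ → Matrix ι κ ℂ} (hE : EntryMeasurable E)
    {a : ℤ →₀ Matrix ι κ ℝ} (ha : specNormSq Φ (fun θ => E θ - firOnCircle a θ) < ⊤) :
    specNormSq Φ E < ⊤ := by
  have h1 : specNormSq Φ (firOnCircle a) < ⊤ :=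
    specNormSq_lt_top_of_continuous hΦ (continuous_firOnCircle a)
  have h2 := specNormSq_sub_le hpos (hE.sub (entryMeasurable_fir a))
    (E' := fun θ => - firOnCircle a θ) (fun i j => (entryMeasurable_fir a i j).neg)
  have h3 : specNormSq Φ (fun θ => - firOnCircle a θ) = specNormSq Φ (firOnCircle a) := by
    simp only [specNormSq_eq, traceForm_neg]
  simp only [sub_neg_eq_add, sub_add_cancel] at h2
  rw [h3] at h2
  exact h2.trans_lt (ENNReal.add_lt_top.2 ⟨ENNReal.mul_lt_top ENNReal.ofNat_lt_top ha,
    ENNReal.mul_lt_top ENNReal.ofNat_lt_top h1⟩)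

theorem IsSpectralRep.specNormSq_lt_top (hΦ : IsSpectralDensity P x Φ) (hpos : PosOnCircle Φ)
    {E : ℝ → Matrix ι κ ℂ} {s : ℤ → Ω → ι → ℝ} (h : IsSpectralRep P x Φ E s) :
    specNormSq Φ E < ⊤ := by
  obtain ⟨a, ha, -⟩ := h.approx
  obtain ⟨n, hn⟩ := (ha.eventually_lt_const ENNReal.zero_lt_top).exists
  exact specNormSq_lt_top_of_approx (continuous_onCircle hΦ) hpos h.entryMeasurable hn

/-- Continuity of the inner product of `L²(P)`, restated for functions instead of classes. -/
theorem tendsto_integral_mul_of_eLpNorm {X Y : Ω → ℝ} {Xn Yn : ℕ → Ω → ℝ} (hX : MemLp X 2 P)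
    (hY : MemLp Y 2 P) (hXn : ∀ n, MemLp (Xn n) 2 P) (hYn : ∀ n, MemLp (Yn n) 2 P)
    (hXlim : Tendsto (fun n => eLpNorm (fun ω => X ω - Xn n ω) 2 P) atTop (𝓝 0))
    (hYlim : Tendsto (fun n => eLpNorm (fun ω => Y ω - Yn n ω) 2 P) atTop (𝓝 0)) :
    Tendsto (fun n => ∫ ω, Xn n ω * Yn n ω ∂P) atTop (𝓝 (∫ ω, X ω * Y ω ∂P)) := by
  have hinner {f g : Ω → ℝ} (hf : MemLp f 2 P) (hg : MemLp g 2 P) :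
      ∫ ω, f ω * g ω ∂P = inner ℝ (hf.toLp f) (hg.toLp g) := by
    rw [L2.inner_def]
    refine integral_congr_ae ?_
    filter_upwards [hf.coeFn_toLp, hg.coeFn_toLp] with ω h1 h2
    rw [h1, h2]; simp [mul_comm]
  have hlim {f : Ω → ℝ} {fn : ℕ → Ω → ℝ} (hf : MemLp f 2 P) (hfn : ∀ n, MemLp (fn n) 2 P)
      (h : Tendsto (fun n => eLpNorm (fun ω => f ω - fn n ω) 2 P) atTop (𝓝 0)) :
      Tendsto (fun n => (hfn n).toLp (fn n)) atTop (𝓝 (hf.toLp f)) := by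
    rw [Lp.tendsto_Lp_iff_tendsto_eLpNorm'']
    refine h.congr fun n => ?_
    rw [← eLpNorm_neg]
    congr 1; ext ω; simp
  rw [hinner hX hY]
  simp only [fun n => hinner (hXn n) (hYn n)]
  exact (hlim hX hXn hXlim).inner (hlim hY hYn hYlim)

theorem IsSpectralRep.integral_eq_zero [IsProbabilityMeasure P] (hx : IsWideSenseStationary P x)
    {E : ℝ → Matrix ι κ ℂ} {s : ℤ → Ω → ι → ℝ} (h : IsSpectralRep P x Φ E s) (t : ℤ) (i : ι) :
    ∫ ω, s t ω i ∂P = 0 := by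
  obtain ⟨a, -, ha⟩ := h.approx
  -- The mean is the inner product with the constant `1`, which is square integrable, so it passes
  -- to the limit.
  have h1 := tendsto_integral_mul_of_eLpNorm (h.memLp t i) (memLp_const (1 : ℝ))
    (fun n => memLp_firApply hx (a n) t i) (fun _ => memLp_const (1 : ℝ)) (ha t i) (by simp)
  simp only [mul_one, integral_firApply hx] at h1
  exact tendsto_nhds_unique tendsto_const_nhds h1 |>.symm

theorem integrableOn_entry (hpos : PosOnCircle Φ) {A : ℝ → Matrix ι κ ℂ} {B : ℝ → Matrix ι' κ ℂ}
    (hA : EntryMeasurable A) (hB : EntryMeasurable B) (hA' : specNormSq Φ A < ⊤)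
    (hB' : specNormSq Φ B < ⊤) (k : ℤ) (i : ι) (j : ι') :
    IntegrableOn (fun θ => circlePt θ ^ k * (A θ * onCircle Φ θ * (B θ).conjTranspose) i j)
      (Set.Ioc (-Real.pi) Real.pi) := by
  have hz : Continuous fun θ => circlePt θ ^ k :=
    continuous_circlePt.zpow₀ k fun θ => Or.inl (circlePt_ne_zero θ)
  refine ⟨(hz.measurable.mul
    (((hA.mul (entryMeasurable_onCircle Φ)).mul hB.conjTranspose) i j)).aestronglyMeasurable, ?_⟩
  rw [HasFiniteIntegral]
  refine lt_of_le_of_lt ?_ (ENNReal.mul_lt_top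
    (ENNReal.rpow_lt_top_of_nonneg one_half_pos.le hA'.ne)
    (ENNReal.rpow_lt_top_of_nonneg one_half_pos.le hB'.ne))
  refine le_trans (lintegral_mono fun θ => ?_) (lintegral_entry_le hpos hA hB i j)
  rw [enorm_mul, ← ofReal_norm (circlePt θ ^ k), norm_zpow, norm_circlePt]
  simp

/-- The isometry for finite filters passes to the limit: covariances converge by continuity of the
inner product, and the integrands converge in `L¹` by Cauchy–Schwarz in `L²(Φ)`. -/
theorem IsSpectralRep.integral_mul_eq (hx : IsWideSenseStationary P x)
    (hΦ : IsSpectralDensity P x Φ) (hpos : PosOnCircle Φ) {E : ℝ → Matrix ι κ ℂ}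
    {s : ℤ → Ω → ι → ℝ} (h : IsSpectralRep P x Φ E s) (t k : ℤ) (i j : ι) :
    ((∫ ω, s (t + k) ω i * s t ω j ∂P : ℝ) : ℂ)
      = (2 * (Real.pi : ℂ))⁻¹ * ∫ θ in (-Real.pi)..Real.pi, circlePt θ ^ k *
        (E θ * onCircle Φ θ * (E θ).conjTranspose) i j := by
  obtain ⟨a, ha, haP⟩ := h.approx
  have hQ := h.specNormSq_lt_top hΦ hpos
  have hEm := h.entryMeasurable
  have ham (n : ℕ) := entryMeasurable_fir (a n)
  have haQ (n : ℕ) : specNormSq Φ (firOnCircle (a n)) < ⊤ :=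
    specNormSq_lt_top_of_continuous (continuous_onCircle hΦ) (continuous_firOnCircle (a n))
  have h1 := tendsto_integral_mul_of_eLpNorm (h.memLp (t + k) i) (h.memLp t j)
    (fun n => memLp_firApply hx (a n) (t + k) i) (fun n => memLp_firApply hx (a n) t j)
    (haP (t + k) i) (haP t j)
  have h2 := (Complex.continuous_ofReal.tendsto _).comp h1
  have h3 : Tendsto (fun n => ∫ θ in (-Real.pi)..Real.pi, circlePt θ ^ k *
        (firOnCircle (a n) θ * onCircle Φ θ * (firOnCircle (a n) θ).conjTranspose) i j) atTop
      (𝓝 (∫ θ in (-Real.pi)..Real.pi, circlePt θ ^ k *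
        (E θ * onCircle Φ θ * (E θ).conjTranspose) i j)) := by
    have hle : -Real.pi ≤ Real.pi := by linarith [Real.pi_pos]
    simp only [intervalIntegral.integral_of_le hle]
    refine tendsto_integral_of_L1 _ (integrableOn_entry hpos hEm hEm hQ hQ k i j).1
      (Eventually.of_forall fun n =>
        integrableOn_entry hpos (ham n) (ham n) (haQ n) (haQ n) k i j) ?_
    set δ : ℕ → ENNReal := fun n => specNormSq Φ fun θ => E θ - firOnCircle (a n) θ
    have hbound (n : ℕ) : specNormSq Φ (firOnCircle (a n)) ≤ 2 * specNormSq Φ E + 2 * δ n := by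
      have := specNormSq_sub_le hpos hEm (hEm.sub (ham n))
      simpa using this
    have hroot {u : ℕ → ENNReal} {l : ENNReal} (hu : Tendsto u atTop (𝓝 l)) :
        Tendsto (fun n => u n ^ (1 / 2 : ℝ)) atTop (𝓝 (l ^ (1 / 2 : ℝ))) :=
      (ENNReal.continuous_rpow_const.tendsto l).comp hu
    have hδ0 : Tendsto (fun n => δ n ^ (1 / 2 : ℝ)) atTop (𝓝 0) := by
      have := hroot ha
      rwa [ENNReal.zero_rpow_of_pos one_half_pos] at this
    have hlim : Tendsto (fun n => δ n ^ (1 / 2 : ℝ) * (2 * specNormSq Φ E + 2 * δ n) ^ (1 / 2 : ℝ)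
        + specNormSq Φ E ^ (1 / 2 : ℝ) * δ n ^ (1 / 2 : ℝ)) atTop (𝓝 0) := by
      have hb : Tendsto (fun n => (2 * specNormSq Φ E + 2 * δ n) ^ (1 / 2 : ℝ)) atTop
          (𝓝 ((2 * specNormSq Φ E + 2 * 0) ^ (1 / 2 : ℝ))) :=
        hroot (tendsto_const_nhds.add (ENNReal.Tendsto.const_mul ha (Or.inr ENNReal.ofNat_ne_top)))
      have hfin : (2 * specNormSq Φ E + 2 * 0) ^ (1 / 2 : ℝ) ≠ ⊤ := by
        refine ENNReal.rpow_ne_top_of_nonneg one_half_pos.le ?_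
        rw [mul_zero, add_zero]
        exact (ENNReal.mul_lt_top ENNReal.ofNat_lt_top hQ).ne
      have h4 := ENNReal.Tendsto.mul hδ0 (Or.inr hfin) hb (Or.inr ENNReal.zero_ne_top)
      have h5 := ENNReal.Tendsto.const_mul (a := specNormSq Φ E ^ (1 / 2 : ℝ)) hδ0
        (Or.inr (ENNReal.rpow_ne_top_of_nonneg one_half_pos.le hQ.ne))
      simpa using h4.add h5
    refine tendsto_of_tendsto_of_tendsto_of_le_of_le tendsto_const_nhds hlim (fun _ => zero_le)
      fun n => ?_
    have hdiff := hEm.sub (ham n)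
    calc _ ≤ ∫⁻ θ in Set.Ioc (-Real.pi) Real.pi,
          (‖((E θ - firOnCircle (a n) θ) * onCircle Φ θ
              * (firOnCircle (a n) θ).conjTranspose) i j‖ₑ
            + ‖(E θ * onCircle Φ θ * (E θ - firOnCircle (a n) θ).conjTranspose) i j‖ₑ) := by
          refine lintegral_mono fun θ => ?_
          -- Telescoping `A Φ A* - E Φ E*` into two terms, each with one factor `E - A` that is
          -- small in `L²(Φ)`.
          have heq : circlePt θ ^ k * (firOnCircle (a n) θ * onCircle Φ θ *
              (firOnCircle (a n) θ).conjTranspose) i j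
              - circlePt θ ^ k * (E θ * onCircle Φ θ * (E θ).conjTranspose) i j
              = -(circlePt θ ^ k * (((E θ - firOnCircle (a n) θ) * onCircle Φ θ
                * (firOnCircle (a n) θ).conjTranspose) i j
                + (E θ * onCircle Φ θ * (E θ - firOnCircle (a n) θ).conjTranspose) i j)) := by
            simp only [Matrix.conjTranspose_sub, Matrix.sub_mul, Matrix.mul_sub, Matrix.sub_apply]
            ring
          rw [heq, enorm_neg, enorm_mul, ← ofReal_norm (circlePt θ ^ k), norm_zpow,
            norm_circlePt, one_zpow, ENNReal.ofReal_one, one_mul]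
          exact enorm_add_le _ _
      _ ≤ δ n ^ (1 / 2 : ℝ) * specNormSq Φ (firOnCircle (a n)) ^ (1 / 2 : ℝ)
          + specNormSq Φ E ^ (1 / 2 : ℝ) * δ n ^ (1 / 2 : ℝ) := by
          rw [lintegral_add_left ((((hdiff.mul (entryMeasurable_onCircle Φ)).mul
            (ham n).conjTranspose) i j).enorm)]
          exact add_le_add (lintegral_entry_le hpos hdiff (ham n) i j)
            (lintegral_entry_le hpos hEm hdiff i j)
      _ ≤ _ := by
          gcongr
          exact hbound n
  refine tendsto_nhds_unique h2 ((h3.const_mul _).congr fun n => ?_)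
  rw [Function.comp_apply, integral_firApply_mul hx hΦ]
end

/-! Rational functions in `L²(Φ)` are limits of finite filters. -/

section
variable {ι κ : Type*} [Fintype ι] [Fintype κ] {Φ : Matrix κ κ (RatFunc ℝ)}

/-- Squared modulus, on the circle, of the product of all denominators of `G`. -/
def denomNormSq (G : Matrix ι κ (RatFunc ℝ)) (θ : ℝ) : ℝ :=
  Complex.normSq (Polynomial.aeval (circlePt θ) (∏ i, ∏ j, (G i j).denom))

theorem prod_denom_ne_zero (G : Matrix ι κ (RatFunc ℝ)) :
    ∏ i, ∏ j, (G i j).denom ≠ 0 :=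
  Finset.prod_ne_zero_iff.2 fun i _ => Finset.prod_ne_zero_iff.2 fun j _ => (G i j).denom_ne_zero

theorem denomNormSq_ae_pos (G : Matrix ι κ (RatFunc ℝ)) : ∀ᵐ θ : ℝ, 0 < denomNormSq G θ := by
  filter_upwards [ae_aeval_ne_zero (prod_denom_ne_zero G)] with θ hθ
  exact Complex.normSq_pos.2 hθ

theorem denomNormSq_nonneg (G : Matrix ι κ (RatFunc ℝ)) (θ : ℝ) : 0 ≤ denomNormSq G θ :=
  Complex.normSq_nonneg _

theorem measurable_denomNormSq (G : Matrix ι κ (RatFunc ℝ)) : Measurable (denomNormSq G) :=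
  (Complex.continuous_normSq.comp
    ((Polynomial.continuous_aeval _).comp continuous_circlePt)).measurable

/-- `G` with its poles on the circle damped. -/
def damped (G : Matrix ι κ (RatFunc ℝ)) (δ : ℝ) (θ : ℝ) : Matrix ι κ ℂ :=
  ((denomNormSq G θ / (denomNormSq G θ + δ) : ℝ) : ℂ) • onCircle G θ

theorem entryMeasurable_damped (G : Matrix ι κ (RatFunc ℝ)) (δ : ℝ) :
    EntryMeasurable (damped G δ) := fun i j => by
  have h := measurable_denomNormSq G
  exact (Complex.measurable_ofReal.comp (h.div (h.add_const δ))).mul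
    (entryMeasurable_onCircle G i j)

/-- The difference is `G` times `δ / (|d|² + δ)`, a factor at most `1` that tends to `0` wherever
the product `d` of the denominators is nonzero. Dominated convergence applies because `G` is in
`L²(Φ)`. -/
theorem specNormSq_sub_damped_tendsto (hpos : PosOnCircle Φ) (G : Matrix ι κ (RatFunc ℝ))
    (hG : specNormSq Φ (onCircle G) < ⊤) :
    Tendsto (fun n : ℕ => specNormSq Φ fun θ => onCircle G θ - damped G (1 / ((n : ℝ) + 1)) θ)
      atTop (𝓝 0) := by
  have hform (n : ℕ) (θ : ℝ) :
      traceForm (onCircle Φ θ) (onCircle G θ - damped G (1 / ((n : ℝ) + 1)) θ)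
      = (1 / ((n : ℝ) + 1) / (denomNormSq G θ + 1 / ((n : ℝ) + 1))) ^ 2
        * traceForm (onCircle Φ θ) (onCircle G θ) := by
    have h1 : 0 < denomNormSq G θ + 1 / ((n : ℝ) + 1) :=
      add_pos_of_nonneg_of_pos (denomNormSq_nonneg G θ) (by positivity)
    rw [← traceForm_smul]
    congr 1
    have h2 : 1 / ((n : ℝ) + 1) / (denomNormSq G θ + 1 / ((n : ℝ) + 1))
        = 1 - denomNormSq G θ / (denomNormSq G θ + 1 / ((n : ℝ) + 1)) := by
      rw [eq_sub_iff_add_eq, ← add_div, add_comm, div_self h1.ne']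
    rw [h2, damped, Complex.ofReal_sub, sub_smul, Complex.ofReal_one, one_smul]
  simp only [specNormSq_eq]
  have hz : (0 : ENNReal) = ∫⁻ _ in Set.Ioc (-Real.pi) Real.pi, 0 := by simp
  rw [hz]
  refine tendsto_lintegral_of_dominated_convergence
    (fun θ => ENNReal.ofReal (traceForm (onCircle Φ θ) (onCircle G θ))) (fun n => ?_)
    (fun n => ?_) hG.ne ?_
  · exact (measurable_traceForm ((entryMeasurable_onCircle G).sub
      (entryMeasurable_damped G _))).ennreal_ofReal
  · refine ae_of_all _ fun θ => ENNReal.ofReal_le_ofReal ?_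
    simp only [hform]
    refine mul_le_of_le_one_left (traceForm_nonneg (hpos θ) _) ?_
    have h1 : 0 < (1 : ℝ) / ((n : ℝ) + 1) := by positivity
    have h2 := denomNormSq_nonneg G θ
    refine pow_le_one₀ (by positivity) ((div_le_one (by positivity)).2 (by linarith))
  · filter_upwards [ae_restrict_of_ae (denomNormSq_ae_pos G)] with θ hθ
    simp only [hform]
    rw [← ENNReal.ofReal_zero]
    refine (ENNReal.continuous_ofReal.tendsto _).comp ?_
    have h1 : Tendsto (fun n : ℕ => 1 / ((n : ℝ) + 1)) atTop (𝓝 0) :=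
      tendsto_one_div_add_atTop_nhds_zero_nat
    have h2 := ((h1.div ((tendsto_const_nhds (x := denomNormSq G θ)).add h1)
      (by simpa using hθ.ne')).pow 2).mul_const (traceForm (onCircle Φ θ) (onCircle G θ))
    simpa using h2

/-- Damping replaces `1/d` by `conj d / (|d|² + δ)`, which is continuous everywhere. Real
coefficients give the conjugation symmetry, so real finite filters approximate uniformly, hence in
`L²(Φ)`. -/
theorem exists_fir_approx_damped (hΦ : ∀ i j, Continuous fun θ => onCircle Φ θ i j)
    (G : Matrix ι κ (RatFunc ℝ)) {δ : ℝ} (hδ : 0 < δ) {ε : ENNReal} (hε : 0 < ε) :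
    ∃ a : ℤ →₀ Matrix ι κ ℝ, specNormSq Φ (fun θ => damped G δ θ - firOnCircle a θ) < ε := by
  set d := ∏ i, ∏ j, (G i j).denom with hd
  have hdvd (i j) : (G i j).denom ∣ d :=
    (Finset.dvd_prod_of_mem (fun j => (G i j).denom) (Finset.mem_univ j)).trans
      (Finset.dvd_prod_of_mem (fun i => ∏ j, (G i j).denom) (Finset.mem_univ i))
  choose e he using hdvd
  let g : ι → κ → ℂ → ℂ := fun i j z =>
    Polynomial.aeval z (G i j).num * Polynomial.aeval z (e i j)
      * (starRingEnd ℂ) (Polynomial.aeval z d) / ((Complex.normSq (Polynomial.aeval z d) + δ : ℝ) : ℂ)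
  have hgc (i j) : ContinuousOn (g i j) (Metric.sphere 0 1) := by
    refine Continuous.continuousOn ?_
    refine Continuous.div (((Polynomial.continuous_aeval _).mul (Polynomial.continuous_aeval _)).mul
      (Complex.continuous_conj.comp (Polynomial.continuous_aeval _)))
      (Complex.continuous_ofReal.comp ((Complex.continuous_normSq.comp
        (Polynomial.continuous_aeval _)).add continuous_const)) fun z => ?_
    exact Complex.ofReal_ne_zero.2 (add_pos_of_nonneg_of_pos (Complex.normSq_nonneg _) hδ).ne'
  have hgs (i j z) (_ : ‖z‖ = 1) : g i j ((starRingEnd ℂ) z) = (starRingEnd ℂ) (g i j z) := by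
    simp only [g, map_div₀, map_mul, Complex.conj_ofReal, conj_aeval, Complex.conj_conj]
    rw [← conj_aeval d z, Complex.normSq_conj]
  have hdamp : ∀ᵐ θ : ℝ, ∀ i j, damped G δ θ i j = g i j (circlePt θ) := by
    filter_upwards [ae_aeval_ne_zero (prod_denom_ne_zero G)] with θ hθ i j
    have hθ' : Polynomial.aeval (circlePt θ) d ≠ 0 := hθ
    have hsplit : Polynomial.aeval (circlePt θ) d
        = Polynomial.aeval (circlePt θ) (G i j).denom * Polynomial.aeval (circlePt θ) (e i j) := by
      rw [← map_mul, ← he]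
    have h1 : Polynomial.aeval (circlePt θ) (G i j).denom ≠ 0 := by
      rw [hsplit] at hθ'; exact left_ne_zero_of_mul hθ'
    have h2 : ((Complex.normSq (Polynomial.aeval (circlePt θ) d) + δ : ℝ) : ℂ) ≠ 0 :=
      Complex.ofReal_ne_zero.2 (add_pos_of_nonneg_of_pos (Complex.normSq_nonneg _) hδ).ne'
    have h3 : damped G δ θ i j = ((Complex.normSq (Polynomial.aeval (circlePt θ) d)
        / (Complex.normSq (Polynomial.aeval (circlePt θ) d) + δ) : ℝ) : ℂ)
        * ratValue (G i j) θ := rfl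
    rw [h3, ratValue_eq_div, Complex.ofReal_div]
    simp only [g]
    rw [div_mul_div_comm, mul_comm _ (Polynomial.aeval (circlePt θ) (G i j).denom),
      div_eq_div_iff (mul_ne_zero h1 h2) h2, ← Complex.mul_conj, hsplit, map_mul]
    ring
  set K : ENNReal := ∫⁻ θ in Set.Ioc (-Real.pi) Real.pi,
      ENNReal.ofReal (Fintype.card ι * ∑ j, ∑ k, ‖onCircle Φ θ j k‖) with hK
  have hKtop : K ≠ ⊤ := (lintegral_norm_lt_top (ι := ι) hΦ).ne
  obtain ⟨η, hη, hηε⟩ : ∃ η : ℝ, 0 < η ∧ ENNReal.ofReal (η ^ 2) * K < ε := by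
    have h1 : Tendsto (fun η : ℝ => ENNReal.ofReal (η ^ 2) * K) (𝓝[>] 0) (𝓝 0) := by
      have h2 : Tendsto (fun η : ℝ => ENNReal.ofReal (η ^ 2)) (𝓝[>] 0) (𝓝 0) := by
        have : Continuous fun η : ℝ => ENNReal.ofReal (η ^ 2) :=
          ENNReal.continuous_ofReal.comp (continuous_pow 2)
        simpa using (this.tendsto 0).mono_left nhdsWithin_le_nhds
      simpa using ENNReal.Tendsto.mul_const h2 (Or.inr hKtop)
    obtain ⟨η, h2, h3⟩ := ((h1.eventually_lt_const hε).and self_mem_nhdsWithin).exists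
    exact ⟨η, h3, h2⟩
  obtain ⟨a, ha⟩ := exists_fir_approx hgc hgs hη
  refine ⟨a, lt_of_le_of_lt ?_ hηε⟩
  have hcongr : specNormSq Φ (fun θ => damped G δ θ - firOnCircle a θ)
      = specNormSq Φ (fun θ => Matrix.of (fun i j => g i j (circlePt θ)) - firOnCircle a θ) := by
    refine specNormSq_congr (ae_restrict_of_ae (hdamp.mono fun θ hθ => ?_))
    congr 1
    ext i j
    exact hθ i j
  rw [hcongr]
  exact specNormSq_le_of_bounded hΦ fun θ i j => (ha θ i j).le

theorem exists_fir_specNormSq_lt (hΦ : ∀ i j, Continuous fun θ => onCircle Φ θ i j)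
    (hpos : PosOnCircle Φ) (G : Matrix ι κ (RatFunc ℝ)) (hG : specNormSq Φ (onCircle G) < ⊤)
    {ε : ENNReal} (hε : 0 < ε) :
    ∃ a : ℤ →₀ Matrix ι κ ℝ, specNormSq Φ (fun θ => onCircle G θ - firOnCircle a θ) < ε := by
  -- Two errors, each doubled by `specNormSq_sub_le`.
  have hε4 : 0 < ε / 4 := ENNReal.div_pos hε.ne' ENNReal.ofNat_ne_top
  obtain ⟨n, hn⟩ := ((specNormSq_sub_damped_tendsto hpos G hG).eventually_lt_const hε4).exists
  obtain ⟨a, ha⟩ := exists_fir_approx_damped hΦ G (δ := 1 / ((n : ℝ) + 1)) (by positivity) hε4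
  refine ⟨a, ?_⟩
  set E := damped G (1 / ((n : ℝ) + 1))
  have hE : EntryMeasurable E := entryMeasurable_damped _ _
  have h := specNormSq_sub_le hpos ((entryMeasurable_onCircle G).sub hE)
    ((entryMeasurable_fir a).sub hE)
  rw [specNormSq_sub_comm (firOnCircle a) E] at h
  simp only [sub_sub_sub_cancel_right] at h
  refine h.trans_lt ?_
  calc _ < 2 * (ε / 4) + 2 * (ε / 4) :=
        ENNReal.add_lt_add ((ENNReal.mul_lt_mul_iff_right two_ne_zero ENNReal.ofNat_ne_top).2 hn)
          ((ENNReal.mul_lt_mul_iff_right two_ne_zero ENNReal.ofNat_ne_top).2 ha)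
    _ = ε := by
        rw [← add_mul]
        norm_num
        exact ENNReal.mul_div_cancel (by norm_num) (by norm_num)
end

/-! ### Existence of filter outputs. -/

section
variable {Ω ι κ : Type*} [MeasurableSpace Ω] [Fintype ι] [Fintype κ]
  {P : Measure Ω} {x : ℤ → Ω → κ → ℝ} {Φ : Matrix κ κ (RatFunc ℝ)}

/-- The isometry in the form of a bound; the factor `(2π)⁻¹ ≤ 1` is dropped. -/
theorem eLpNorm_firApply_le (hx : IsWideSenseStationary P x) (hΦ : IsSpectralDensity P x Φ)
    (hpos : PosOnCircle Φ) (a : ℤ →₀ Matrix ι κ ℝ) (t : ℤ) (i : ι) :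
    eLpNorm (fun ω => firApply a x t ω i) 2 P ≤ specNormSq Φ (firOnCircle a) ^ (1 / 2 : ℝ) := by
  have hmem := memLp_firApply hx a t i
  have hint : Integrable (fun ω => firApply a x t ω i * firApply a x t ω i) P :=
    hmem.integrable_mul hmem
  have h1 := integral_firApply_mul hx hΦ a a t 0 i i
  simp only [add_zero, zpow_zero, one_mul] at h1
  have hQ : specNormSq Φ (firOnCircle a) < ⊤ :=
    specNormSq_lt_top_of_continuous (continuous_onCircle hΦ) (continuous_firOnCircle a)
  have hle : -Real.pi ≤ Real.pi := by linarith [Real.pi_pos]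
  have hm := entryMeasurable_fir a
  have h2 : ∫ ω, firApply a x t ω i * firApply a x t ω i ∂P
      ≤ (specNormSq Φ (firOnCircle a)).toReal := by
    have h3 : ‖∫ θ in (-Real.pi)..Real.pi,
        (firOnCircle a θ * onCircle Φ θ * (firOnCircle a θ).conjTranspose) i i‖
        ≤ (specNormSq Φ (firOnCircle a)).toReal := by
      rw [intervalIntegral.integral_of_le hle]
      have h4 := lintegral_entry_le hpos hm hm i i
      rw [← ENNReal.rpow_add_of_nonneg _ _ one_half_pos.le one_half_pos.le, add_halves,
        ENNReal.rpow_one] at h4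
      refine (norm_integral_le_lintegral_norm _).trans (ENNReal.toReal_mono hQ.ne ?_)
      simpa only [ofReal_norm] using h4
    have h5 := congrArg norm h1
    rw [norm_mul, Complex.norm_real, norm_inv, norm_mul, Complex.norm_ofNat, Complex.norm_real,
      Real.norm_of_nonneg Real.pi_pos.le] at h5
    refine (Real.le_norm_self _).trans (h5.trans_le ?_)
    refine le_trans (mul_le_of_le_one_left (norm_nonneg _) ?_) h3
    exact inv_le_one_of_one_le₀ (by nlinarith [Real.pi_gt_three])
  rw [eLpNorm_eq_lintegral_rpow_enorm_toReal two_ne_zero ENNReal.ofNat_ne_top]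
  simp only [ENNReal.toReal_ofNat]
  refine ENNReal.rpow_le_rpow ?_ one_half_pos.le
  have h6 : ∫⁻ ω, ‖firApply a x t ω i‖ₑ ^ (2 : ℝ) ∂P
      = ENNReal.ofReal (∫ ω, firApply a x t ω i * firApply a x t ω i ∂P) := by
    rw [ofReal_integral_eq_lintegral_ofReal hint (ae_of_all _ fun ω => mul_self_nonneg _)]
    refine lintegral_congr fun ω => ?_
    rw [← ofReal_norm, ENNReal.ofReal_rpow_of_nonneg (norm_nonneg _) zero_le_two,
      Real.rpow_two, Real.norm_eq_abs, sq_abs, sq]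
  rw [h6]
  exact ENNReal.ofReal_le_of_le_toReal h2

/-- Every matrix function that finite filters approximate has an output. -/
theorem exists_isSpectralRep (hx : IsWideSenseStationary P x) (hΦ : IsSpectralDensity P x Φ)
    (hpos : PosOnCircle Φ) {E : ℝ → Matrix ι κ ℂ} (hE : EntryMeasurable E)
    (happ : ∀ ε : ENNReal, 0 < ε →
      ∃ a : ℤ →₀ Matrix ι κ ℝ, specNormSq Φ (fun θ => E θ - firOnCircle a θ) < ε) :
    ∃ s : ℤ → Ω → ι → ℝ, IsSpectralRep P x Φ E s := by
  set B : ℕ → ENNReal := fun n => ENNReal.ofReal ((1 / 2 : ℝ) ^ n) with hB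
  have hBpos (n : ℕ) : 0 < B n := ENNReal.ofReal_pos.2 (by positivity)
  have hBtop (n : ℕ) : B n ≠ ⊤ := ENNReal.ofReal_ne_top
  have hBsum : ∑' n, B n ≠ ⊤ := by
    rw [hB, ← ENNReal.ofReal_tsum_of_nonneg (fun n => by positivity)
      (summable_geometric_of_lt_one (by norm_num) (by norm_num))]
    exact ENNReal.ofReal_ne_top
  have hBanti {m n : ℕ} (h : m ≤ n) : B n ≤ B m :=
    ENNReal.ofReal_le_ofReal (pow_le_pow_of_le_one (by norm_num) (by norm_num) h)
  -- The Cauchy estimate doubles two squared errors, `2 · B²/4 + 2 · B²/4 = B²`, and a square root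
  -- leaves `B n = 2⁻ⁿ`, summable as `Lp.cauchy_complete_eLpNorm` demands.
  have hsq (n : ℕ) : 0 < B n ^ (2 : ℝ) / 4 :=
    ENNReal.div_pos (ENNReal.rpow_pos (hBpos n) (hBtop n)).ne' ENNReal.ofNat_ne_top
  choose a ha using fun n => happ _ (hsq n)
  have hcauchy (t : ℤ) (i : ι) (N n m : ℕ) (hn : N ≤ n) (hm : N ≤ m) :
      eLpNorm ((fun ω => firApply (a n) x t ω i) - fun ω => firApply (a m) x t ω i) 2 P < B N := by
    have h1 : ((fun ω => firApply (a n) x t ω i) - fun ω => firApply (a m) x t ω i)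
        = fun ω => firApply (a n - a m) x t ω i := by
      ext ω; simp [firApply_sub]
    rw [h1]
    refine (eLpNorm_firApply_le hx hΦ hpos (a n - a m) t i).trans_lt ?_
    have h2 : specNormSq Φ (firOnCircle (a n - a m)) < B N ^ (2 : ℝ) := by
      have h3 := specNormSq_sub_le hpos (hE.sub (entryMeasurable_fir (a m)))
        (hE.sub (entryMeasurable_fir (a n)))
      have h4 : (fun θ => E θ - firOnCircle (a m) θ - (E θ - firOnCircle (a n) θ))
          = firOnCircle (a n - a m) := by
        ext θ : 1; rw [firOnCircle_sub]; abel
      rw [h4] at h3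
      have hmono {k : ℕ} (hk : N ≤ k) : specNormSq Φ (fun θ => E θ - firOnCircle (a k) θ)
          < B N ^ (2 : ℝ) / 4 :=
        (ha k).trans_le (ENNReal.div_le_div_right (ENNReal.rpow_le_rpow (hBanti hk) zero_le_two) _)
      refine h3.trans_lt ?_
      calc _ < 2 * (B N ^ (2 : ℝ) / 4) + 2 * (B N ^ (2 : ℝ) / 4) := ENNReal.add_lt_add
            ((ENNReal.mul_lt_mul_iff_right two_ne_zero ENNReal.ofNat_ne_top).2 (hmono hm))
            ((ENNReal.mul_lt_mul_iff_right two_ne_zero ENNReal.ofNat_ne_top).2 (hmono hn))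
        _ = B N ^ (2 : ℝ) := by
          rw [← add_mul]
          norm_num
          exact ENNReal.mul_div_cancel (by norm_num) (by norm_num)
    have h5 := ENNReal.rpow_lt_rpow h2 one_half_pos
    rwa [← ENNReal.rpow_mul, mul_one_div_cancel two_ne_zero, ENNReal.rpow_one] at h5
  choose s hs hslim using fun t i => Lp.cauchy_complete_eLpNorm one_le_two
    (fun n => memLp_firApply hx (a n) t i) hBsum (hcauchy t i)
  refine ⟨fun t ω i => s t i ω, hE, fun t i => hs t i, a, ?_, fun t i => ?_⟩
  · have h0 : Tendsto B atTop (𝓝 0) := by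
      have := (ENNReal.continuous_ofReal.tendsto 0).comp
        (tendsto_pow_atTop_nhds_zero_of_lt_one (r := (1 / 2 : ℝ)) (by norm_num) (by norm_num))
      rwa [ENNReal.ofReal_zero] at this
    refine tendsto_of_tendsto_of_tendsto_of_le_of_le tendsto_const_nhds h0 (fun _ => zero_le)
      fun n => (ha n).le.trans ?_
    refine ENNReal.div_le_of_le_mul ?_
    have hB1 : B n ≤ 1 := by simpa [hB] using hBanti (Nat.zero_le n)
    rw [ENNReal.rpow_two, sq]
    gcongr
    exact hB1.trans (by norm_num)
  · refine (hslim t i).congr fun n => ?_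
    rw [← eLpNorm_neg]
    congr 1; ext ω; simp

theorem exists_isFilterOutput (hx : IsWideSenseStationary P x) (hΦ : IsSpectralDensity P x Φ)
    (hpos : PosOnCircle Φ) (G : Matrix ι κ (RatFunc ℝ)) (hG : specNormSq Φ (onCircle G) < ⊤) :
    ∃ s : ℤ → Ω → ι → ℝ, IsFilterOutput P x Φ G s := by
  obtain ⟨s, hs⟩ := exists_isSpectralRep hx hΦ hpos (entryMeasurable_onCircle G)
    fun ε hε => exists_fir_specNormSq_lt (continuous_onCircle hΦ) hpos G hG hε
  exact ⟨s, hs.isFilterOutput⟩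
end

/-! Outputs of filters driven by a subvector process. -/

section
variable {Ω ι κ : Type*} [MeasurableSpace Ω] {P : Measure Ω} {x : ℤ → Ω → ι → ℝ}
  {Φ : Matrix ι ι (RatFunc ℝ)}

theorem IsWideSenseStationary.subprocess (hx : IsWideSenseStationary P x) (f : κ → ι) :
    IsWideSenseStationary P (subprocess x f) where
  memLp t i := hx.memLp t (f i)
  mean_zero t i := hx.mean_zero t (f i)
  cov_shift s t k i j := hx.cov_shift s t k (f i) (f j)

theorem IsSpectralDensity.subprocess (hΦ : IsSpectralDensity P x Φ) (f : κ → ι) :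
    IsSpectralDensity P (subprocess x f) (Φ.submatrix f f) where
  no_pole i j := hΦ.no_pole (f i) (f j)
  cov_eq t k i j := hΦ.cov_eq t k (f i) (f j)

theorem IsSpectralDensity.isWideSenseStationary {s : ℤ → Ω → ι → ℝ}
    (h : IsSpectralDensity P s Φ) (hm : ∀ t i, MemLp (fun ω => s t ω i) 2 P)
    (h0 : ∀ t i, ∫ ω, s t ω i ∂P = 0) : IsWideSenseStationary P s where
  memLp := hm
  mean_zero := h0
  cov_shift t t' k i j := by
    have h1 := (h.cov_eq t k i j).trans (h.cov_eq t' k i j).symm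
    exact_mod_cast h1

end

/-- The rational (constant) matrix that selects the components `f`. -/
def selection {ι κ : Type*} [DecidableEq ι] (f : κ → ι) : Matrix κ ι (RatFunc ℝ) :=
  (1 : Matrix ι ι (RatFunc ℝ)).submatrix f id

section
variable {ι κ ν : Type*} [DecidableEq ι]

theorem onCircle_selection (f : κ → ι) (θ : ℝ) : onCircle (selection f) θ
    = ((1 : Matrix ι ι ℝ).submatrix f id).map (fun c : ℝ => (c : ℂ)) := by
  ext i j
  have h := congrFun (congrFun (onCircle_one (ι := ι) θ) (f i)) j
  rw [onCircle_apply] at h ⊢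
  rw [selection, Matrix.submatrix_apply, id, h]
  simp only [Matrix.map_apply, Matrix.submatrix_apply, id, Matrix.one_apply]
  split_ifs <;> simp

theorem selection_map_paraConj (f : κ → ι) : (selection f).map paraConj = selection f := by
  ext i j
  simp [selection, Matrix.one_apply, apply_ite paraConj]

variable [Fintype ι]

theorem selection_mul {μ : Type*} (f : κ → ι) (A : Matrix ι μ (RatFunc ℝ)) :
    selection f * A = A.submatrix f id := by
  ext i j
  simp [selection, Matrix.mul_apply, Matrix.one_apply]

theorem mul_selection_transpose {μ : Type*} (f : κ → ι) (A : Matrix μ ι (RatFunc ℝ)) :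
    A * (selection f).transpose = A.submatrix id f := by
  ext i j
  simp [selection, Matrix.mul_apply, Matrix.one_apply]

variable [Fintype κ] [Fintype ν]

theorem traceForm_mul_submatrix (M : Matrix ι ι ℂ) (f : κ → ι) (A : Matrix ν κ ℂ) :
    traceForm M (A * ((1 : Matrix ι ι ℝ).submatrix f id).map (fun c : ℝ => (c : ℂ)))
      = traceForm (M.submatrix f f) A := by
  set S := ((1 : Matrix ι ι ℝ).submatrix f id).map (fun c : ℝ => (c : ℂ))
  have h : S * M * S.conjTranspose = M.submatrix f f := by
    ext i j
    simp [S, mul_mul_conjTranspose_apply, Matrix.one_apply, apply_ite]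
  simp only [traceForm, Matrix.conjTranspose_mul, ← h, Matrix.mul_assoc]

variable {Ω : Type*} [MeasurableSpace Ω] {P : Measure Ω} {x : ℤ → Ω → ι → ℝ}
  {Φ : Matrix ι ι (RatFunc ℝ)}

/-- Together with `IsFilterOutput.isSpectralRep_mul_selection` this represents `u`, `y`, `F u` and
`H y` as filters of one process, so that they can be subtracted. -/
theorem isSpectralRep_selection (hx : IsWideSenseStationary P x) (f : κ → ι) :
    IsSpectralRep P x Φ (onCircle (selection f)) (subprocess x f) := by
  refine (isSpectralRep_fir hx (Finsupp.single 0 ((1 : Matrix ι ι ℝ).submatrix f id))).congr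
    (entryMeasurable_onCircle _) (ae_of_all _ fun θ => ?_) fun t i => ae_of_all _ fun ω => ?_
  · rw [firOnCircle_single, onCircle_selection]
  · simp only [firApply_single]
    simp [subprocess, Matrix.mulVec, dotProduct, Matrix.one_apply]

theorem specNormSq_mul_selection (f : κ → ι) (G : Matrix ν κ (RatFunc ℝ)) :
    specNormSq Φ (onCircle (G * selection f)) = specNormSq (Φ.submatrix f f) (onCircle G) := by
  simp only [specNormSq_eq]
  refine lintegral_congr_ae (ae_restrict_of_ae ((onCircle_mul G (selection f)).mono fun θ hθ => ?_))
  simp only [hθ, onCircle_selection, traceForm_mul_submatrix]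
  rfl

/-- A filter driven by a subvector process is a filter driven by the whole process. -/
theorem IsFilterOutput.isSpectralRep_mul_selection {f : κ → ι} {G : Matrix ν κ (RatFunc ℝ)}
    {s : ℤ → Ω → ν → ℝ} (h : IsFilterOutput P (subprocess x f) (Φ.submatrix f f) G s) :
    IsSpectralRep P x Φ (onCircle (G * selection f)) s := by
  obtain ⟨a, ha, ha'⟩ := h.approx
  set S : Matrix κ ι ℝ := (1 : Matrix ι ι ℝ).submatrix f id with hS
  refine ⟨entryMeasurable_onCircle _, h.memLp,
    fun n => (a n).mapRange (· * S) (Matrix.zero_mul S), ha.congr fun n => ?_, fun t i => ?_⟩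
  · simp only [specNormSq_eq]
    refine lintegral_congr_ae
      (ae_restrict_of_ae ((onCircle_mul G (selection f)).mono fun θ hθ => ?_))
    simp only [hθ, onCircle_selection, firOnCircle_mapRange_mul]
    rw [← hS, ← Matrix.sub_mul, hS, traceForm_mul_submatrix]
    rfl
  · refine (ha' t i).congr fun n => ?_
    congr 1; ext ω
    rw [firApply_mapRange_mul]
    congr 3
    ext t ω k
    simp [subprocess, hS, Matrix.mulVec, dotProduct, Matrix.one_apply]

end

/-! ### Vanishing outputs and spectral densities of outputs. -/

section
variable {Ω ι κ : Type*} [MeasurableSpace Ω] [Fintype ι] [Fintype κ] {P : Measure Ω}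
  {x : ℤ → Ω → ι → ℝ} {Φ : Matrix ι ι (RatFunc ℝ)}

open scoped ComplexOrder in
theorem PosOnCircle.conjTranspose_eq (hpos : PosOnCircle Φ) (θ : ℝ) :
    (onCircle Φ θ).conjTranspose = onCircle Φ θ := (hpos θ).isHermitian.eq

theorem IsSpectralRep.onCircle_sub (hx : IsWideSenseStationary P x) (hpos : PosOnCircle Φ)
    {G G' : Matrix κ ι (RatFunc ℝ)} {s s' : ℤ → Ω → κ → ℝ}
    (h : IsSpectralRep P x Φ (onCircle G) s) (h' : IsSpectralRep P x Φ (onCircle G') s') :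
    IsSpectralRep P x Φ (onCircle (G - G')) (fun t ω i => s t ω i - s' t ω i) :=
  (h.sub hx hpos h').congr (entryMeasurable_onCircle _)
    (ae_restrict_of_ae ((_root_.onCircle_sub G G').mono fun _ hθ => hθ.symm))
    fun _ _ => ae_of_all _ fun _ => rfl

/-- Zero variance makes the integral of the nonnegative function `tr (K Φ K*)` vanish, so `K Φ = 0`
almost everywhere on the circle by semidefiniteness, and then identically. -/
theorem IsSpectralRep.mul_eq_zero (hx : IsWideSenseStationary P x)
    (hΦ : IsSpectralDensity P x Φ) (hpos : PosOnCircle Φ) {K : Matrix κ ι (RatFunc ℝ)}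
    {s : ℤ → Ω → κ → ℝ} (h : IsSpectralRep P x Φ (onCircle K) s)
    (hs : ∀ t i, (fun ω => s t ω i) =ᵐ[P] 0) : K * Φ = 0 := by
  have hK := h.entryMeasurable
  have hQ := h.specNormSq_lt_top hΦ hpos
  have hle : -Real.pi ≤ Real.pi := by linarith [Real.pi_pos]
  have hint (i : κ) := integrableOn_entry hpos hK hK hQ hQ 0 i i
  simp only [zpow_zero, one_mul] at hint
  have h0 (i : κ) : ∫ θ in Set.Ioc (-Real.pi) Real.pi,
      (onCircle K θ * onCircle Φ θ * (onCircle K θ).conjTranspose) i i = 0 := by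
    have h1 := h.integral_mul_eq hx hΦ hpos 0 0 i i
    have h2 : ∫ ω, s (0 + 0) ω i * s 0 ω i ∂P = 0 := by
      rw [← integral_zero Ω ℝ (μ := P)]
      refine integral_congr_ae ((hs 0 i).mono fun ω hω => ?_)
      simp only [Pi.zero_apply] at hω
      simp [hω]
    rw [h2, intervalIntegral.integral_of_le hle] at h1
    simp only [zpow_zero, one_mul, Complex.ofReal_zero] at h1
    exact (_root_.mul_eq_zero.1 h1.symm).resolve_left
      (inv_ne_zero (mul_ne_zero two_ne_zero (Complex.ofReal_ne_zero.2 Real.pi_ne_zero)))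
  have hint' (i : κ) : Integrable (fun θ => ((onCircle K θ * onCircle Φ θ *
      (onCircle K θ).conjTranspose) i i).re)
      (volume.restrict (Set.Ioc (-Real.pi) Real.pi)) := (hint i).re
  have htr : ∫ θ in Set.Ioc (-Real.pi) Real.pi, traceForm (onCircle Φ θ) (onCircle K θ) = 0 := by
    simp only [traceForm, Matrix.trace, Matrix.diag_apply, Complex.re_sum]
    rw [integral_finsetSum _ fun i _ => hint' i]
    refine Finset.sum_eq_zero fun i _ => ?_
    have := integral_re (hint i)
    simp only [RCLike.re_to_complex] at this
    rw [this, h0 i, Complex.zero_re]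
  have hti : IntegrableOn (fun θ => traceForm (onCircle Φ θ) (onCircle K θ))
      (Set.Ioc (-Real.pi) Real.pi) := by
    simp only [traceForm, Matrix.trace, Matrix.diag_apply, Complex.re_sum]
    exact integrable_finsetSum _ fun i _ => hint' i
  have hae := (integral_eq_zero_iff_of_nonneg
    (fun θ => traceForm_nonneg (hpos θ) (onCircle K θ)) hti).1 htr
  refine eq_zero_of_onCircle_ae_zero ?_
  filter_upwards [hae, ae_restrict_of_ae (onCircle_mul K Φ)] with θ h1 h2
  rw [h2]
  exact mul_eq_zero_of_traceForm (hpos θ) h1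

theorem IsSpectralRep.ae_eq_zero (hx : IsWideSenseStationary P x)
    (hΦ : IsSpectralDensity P x Φ) (hpos : PosOnCircle Φ) {K : Matrix κ ι (RatFunc ℝ)}
    {s : ℤ → Ω → κ → ℝ} (h : IsSpectralRep P x Φ (onCircle K) s) (hK : K * Φ = 0) (t : ℤ) (i : κ) :
    (fun ω => s t ω i) =ᵐ[P] 0 := by
  have h1 := h.integral_mul_eq hx hΦ hpos t 0 i i
  have hle : -Real.pi ≤ Real.pi := by linarith [Real.pi_pos]
  have h2 : ∫ θ in (-Real.pi)..Real.pi, circlePt θ ^ (0 : ℤ) *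
      (onCircle K θ * onCircle Φ θ * (onCircle K θ).conjTranspose) i i = 0 := by
    rw [intervalIntegral.integral_of_le hle, ← integral_zero ℝ ℂ]
    refine integral_congr_ae (ae_restrict_of_ae ((onCircle_mul K Φ).mono fun θ hθ => ?_))
    have : onCircle (0 : Matrix κ ι (RatFunc ℝ)) θ = 0 := by
      ext i j; exact ratValue_zero θ
    simp only [← hθ, hK, this, Matrix.zero_mul, Matrix.zero_apply, mul_zero]
  rw [h2, mul_zero, add_zero, Complex.ofReal_eq_zero] at h1
  have hm := h.memLp t i
  have h3 := (integral_eq_zero_iff_of_nonneg (fun ω => mul_self_nonneg (s t ω i))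
    (hm.integrable_mul hm)).1 h1
  exact h3.mono fun ω hω => by simpa using hω

/-- The process with spectral representation `L` has spectral density `L Φ L~`. -/
theorem IsSpectralRep.isSpectralDensity (hx : IsWideSenseStationary P x)
    (hΦ : IsSpectralDensity P x Φ) (hpos : PosOnCircle Φ) {L : Matrix κ ι (RatFunc ℝ)}
    {s : ℤ → Ω → κ → ℝ} (h : IsSpectralRep P x Φ (onCircle L) s) :
    IsSpectralDensity P s (L * Φ * (L.map paraConj).transpose) := by
  have hL := h.entryMeasurable
  have hQ := h.specNormSq_lt_top hΦ hpos
  have hle : -Real.pi ≤ Real.pi := by linarith [Real.pi_pos]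
  have hval : ∀ᵐ θ : ℝ, onCircle (L * Φ * (L.map paraConj).transpose) θ
      = onCircle L θ * onCircle Φ θ * (onCircle L θ).conjTranspose := by
    filter_upwards [onCircle_mul (L * Φ) (L.map paraConj).transpose, onCircle_mul L Φ,
      onCircle_paraConj L] with θ h1 h2 h3
    rw [h1, h2, h3]
  constructor
  · intro i j
    -- `L` itself may have poles on the circle. The product has none, because it is rational and `L
    -- ∈ L²(Φ)` makes it integrable.
    refine denom_ne_zero_of_integrable ?_
    rw [intervalIntegrable_iff_integrableOn_Ioc_of_le hle]
    have h1 := integrableOn_entry hpos hL hL hQ hQ 0 i j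
    simp only [zpow_zero, one_mul] at h1
    refine Integrable.congr h1 (ae_restrict_of_ae (hval.mono fun θ hθ => ?_))
    rw [← onCircle_apply, hθ]
  · intro t k i j
    rw [h.integral_mul_eq hx hΦ hpos, intervalIntegral.integral_of_le hle,
      intervalIntegral.integral_of_le hle]
    congr 1
    refine integral_congr_ae (ae_restrict_of_ae (hval.mono fun θ hθ => ?_))
    simp only [hθ]

/-- Hermitian symmetry at the points of the circle, lifted to an identity of rational matrices. -/
theorem paraConj_transpose_eq (hpos : PosOnCircle Φ) : (Φ.map paraConj).transpose = Φ := by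
  rw [← sub_eq_zero]
  refine eq_zero_of_onCircle_ae_zero (ae_restrict_of_ae ?_)
  filter_upwards [onCircle_sub (Φ.map paraConj).transpose Φ, onCircle_paraConj Φ] with θ h1 h2
  rw [h1, h2, hpos.conjTranspose_eq θ, sub_self]
end

/-! Diagonalization of matrices over a principal ideal domain. -/

/-- Smith normal form, with the unimodular factors cut down to the rank. -/
theorem Matrix.exists_diagonal_factorization {R : Type*} [CommRing R] [IsDomain R]
    [IsPrincipalIdealRing R] {q m : ℕ} (A : Matrix (Fin q) (Fin m) R) :
    ∃ (r : ℕ) (B : Matrix (Fin q) (Fin r) R) (B' : Matrix (Fin r) (Fin q) R)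
      (C : Matrix (Fin r) (Fin m) R) (C' : Matrix (Fin m) (Fin r) R) (a : Fin r → R),
      B' * B = 1 ∧ C * C' = 1 ∧ A = B * Matrix.diagonal a * C := by
  -- The range of `A` has a basis of multiples `a_k` of part of a basis of `R^q`. `B` and `B'` embed
  -- and read off that part, `C` takes coordinates of `A v` in the range, and `C'` lifts the basis
  -- of the range.
  obtain ⟨r, snf⟩ := (LinearMap.range A.mulVecLin).smithNormalForm (Pi.basisFun R (Fin q))
  have hw (k : Fin r) : ∃ v, A.mulVecLin.rangeRestrict v = snf.bN k :=
    A.mulVecLin.surjective_rangeRestrict _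
  choose w hw using hw
  let β : (Fin r → R) →ₗ[R] (Fin q → R) :=
    (Pi.basisFun R (Fin r)).constr R fun k => snf.bM (snf.f k)
  let β' : (Fin q → R) →ₗ[R] (Fin r → R) := LinearMap.pi fun k => snf.bM.coord (snf.f k)
  let γ : (Fin m → R) →ₗ[R] (Fin r → R) :=
    snf.bN.equivFun.toLinearMap ∘ₗ A.mulVecLin.rangeRestrict
  let γ' : (Fin r → R) →ₗ[R] (Fin m → R) := (Pi.basisFun R (Fin r)).constr R w
  have hβ (v : Fin r → R) : β v = ∑ k, v k • snf.bM (snf.f k) := by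
    simp [β, Module.Basis.constr_apply_fintype]
  refine ⟨r, LinearMap.toMatrix' β, LinearMap.toMatrix' β', LinearMap.toMatrix' γ,
    LinearMap.toMatrix' γ', snf.a, ?_, ?_, ?_⟩
  · rw [← LinearMap.toMatrix'_comp, ← LinearMap.toMatrix'_id]
    congr 1
    refine (Pi.basisFun R (Fin r)).ext fun k => ?_
    ext l
    rw [LinearMap.comp_apply, LinearMap.id_apply, Module.Basis.constr_basis, LinearMap.pi_apply,
      Module.Basis.coord_apply, Module.Basis.repr_self, Finsupp.single_apply, Pi.basisFun_apply,
      Pi.single_apply]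
    simp only [snf.f.injective.eq_iff, eq_comm]
  · rw [← LinearMap.toMatrix'_comp, ← LinearMap.toMatrix'_id]
    congr 1
    refine (Pi.basisFun R (Fin r)).ext fun k => ?_
    ext l
    simp only [γ, γ', LinearMap.comp_apply, Module.Basis.constr_basis, hw]
    simp [Pi.single_apply, eq_comm]
  · have h : A.mulVecLin = β ∘ₗ (Matrix.toLin' (Matrix.diagonal snf.a)) ∘ₗ γ := by
      refine LinearMap.ext fun v => ?_
      simp only [LinearMap.comp_apply, hβ]
      have h1 : (A.mulVecLin v) = ((A.mulVecLin.rangeRestrict v : LinearMap.range A.mulVecLin) :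
        Fin q → R) := rfl
      rw [h1]
      conv_lhs => rw [← snf.bN.sum_equivFun (A.mulVecLin.rangeRestrict v)]
      rw [Submodule.coe_sum]
      refine Finset.sum_congr rfl fun k _ => ?_
      rw [Submodule.coe_smul, snf.snf, Matrix.toLin'_apply, Matrix.mulVec_diagonal, smul_smul,
        mul_comm]
      rfl
    have h2 : A = LinearMap.toMatrix' A.mulVecLin := by
      rw [← Matrix.toLin'_apply', LinearMap.toMatrix'_toLin']
    refine h2.trans ((congrArg LinearMap.toMatrix' h).trans ?_)
    rw [LinearMap.toMatrix'_comp, LinearMap.toMatrix'_comp, LinearMap.toMatrix'_toLin',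
      Matrix.mul_assoc]

/-! Solutions of the Bézout identity without zeros on the circle. -/

section
variable {n d b a : Polynomial ℝ}

theorem aeval_ne_zero_of_bezout (h : a * n + b * d = 1) {z : ℂ}
    (hn : Polynomial.aeval z n = 0) : Polynomial.aeval z b ≠ 0 := by
  intro hb
  have := congrArg (Polynomial.aeval z) h
  simp [hn, hb] at this

/-- There is a multiplier `κ` such that `b + c κ n` with real `c ≠ 0` has its zeros on the circle
in a fixed finite set. -/
theorem exists_multiplier (h : a * n + b * d = 1) :
    ∃ κ : Polynomial ℝ, Polynomial.aeval (0 : ℂ) κ ≠ 0 ∧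
      (∀ z : ℂ, ‖z‖ = 1 → Polynomial.aeval z κ ≠ 0) ∧
      ∃ E : Set ℂ, E.Finite ∧ ∀ z : ℂ, ‖z‖ = 1 → z ∉ E → ∀ c : ℝ, c ≠ 0 →
        Polynomial.aeval z b + c * Polynomial.aeval z κ * Polynomial.aeval z n ≠ 0 := by
  set N := max b.natDegree n.natDegree
  -- On the circle `p` is `2i z^N Im (b conj n)`. Where `b + c n = 0` with `c` real, `b conj n` is
  -- real and `p` vanishes; so if `p ≠ 0` the roots of `p` serve as `E`, with `κ = 1`.
  set p := b * Polynomial.reflect N n - Polynomial.reflect N b * n with hp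
  have hconj {z : ℂ} (hz : ‖z‖ = 1) : z⁻¹ = (starRingEnd ℂ) z := by
    rw [Complex.inv_def, Complex.normSq_eq_norm_sq, hz]; simp
  have hpz (z : ℂ) (hz : ‖z‖ = 1) : Polynomial.aeval z p = z ^ N *
      (Polynomial.aeval z b * (starRingEnd ℂ) (Polynomial.aeval z n)
        - (starRingEnd ℂ) (Polynomial.aeval z b) * Polynomial.aeval z n) := by
    have hz0 : z ≠ 0 := by rintro rfl; simp at hz
    rw [hp, map_sub, map_mul, map_mul, aeval_reflect_eq N n (le_max_right _ _) hz0,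
      aeval_reflect_eq N b (le_max_left _ _) hz0, hconj hz, conj_aeval, conj_aeval]
    ring
  by_cases hp0 : p = 0
  · refine ⟨Polynomial.C 2 + Polynomial.X, by simp, fun z hz h0 => ?_, {1, -1}, by simp, ?_⟩
    · have h1 : z = -2 := by
        simp at h0
        linear_combination h0
      rw [h1] at hz
      norm_num at hz
    · intro z hz hzE c hc h0
      have hz0 : z ≠ 0 := by rintro rfl; simp at hz
      have h1 := hpz z hz
      rw [hp0, map_zero] at h1
      have h2 := (mul_eq_zero.1 h1.symm).resolve_left (pow_ne_zero _ hz0)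
      have hn : Polynomial.aeval z n ≠ 0 := by
        intro hn
        rw [hn, mul_zero, add_zero] at h0
        exact aeval_ne_zero_of_bezout h hn h0
      have h3 : Polynomial.aeval z b = -(c * (2 + z) * Polynomial.aeval z n) := by
        have : Polynomial.aeval z (Polynomial.C 2 + Polynomial.X : Polynomial ℝ) = 2 + z := by
          simp
        rw [this] at h0
        linear_combination h0
      rw [h3] at h2
      simp only [map_neg, map_mul, map_add, Complex.conj_ofReal, Complex.conj_ofNat] at h2
      have h4 : (c : ℂ) * Polynomial.aeval z n * (starRingEnd ℂ) (Polynomial.aeval z n)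
          * (z - (starRingEnd ℂ) z) = 0 := by linear_combination -h2
      have h5 := (mul_eq_zero.1 h4).resolve_left (mul_ne_zero (mul_ne_zero
        (Complex.ofReal_ne_zero.2 hc) hn) ((map_ne_zero _).2 hn))
      rw [← hconj hz, sub_eq_zero] at h5
      have h6 : z * z = 1 := by
        nth_rewrite 2 [h5]
        exact mul_inv_cancel₀ hz0
      rcases mul_self_eq_one_iff.1 h6 with h7 | h7 <;> exact hzE (by simp [h7])
  · refine ⟨1, by simp, fun z _ => by simp, p.rootSet ℂ, Polynomial.rootSet_finite _ _, ?_⟩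
    intro z hz hzE c _ h0
    refine hzE (Polynomial.mem_rootSet.2 ⟨hp0, ?_⟩)
    have h3 : Polynomial.aeval z b = -(c * Polynomial.aeval z n) := by
      simp only [map_one, mul_one] at h0
      linear_combination h0
    rw [hpz z hz, h3]
    simp only [map_neg, map_mul, Complex.conj_ofReal]
    ring

/-- All `b + c κ n` are admissible in the Bézout identity. Off the finite set `E` every `c ≠ 0`
works on the circle, and each remaining point, including `0`, rules out at most one `c`. -/
theorem exists_bezout_ne_zero (h : IsCoprime n d) :
    ∃ x y : Polynomial ℝ, x * d + y * n = 1 ∧ x.eval 0 ≠ 0 ∧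
      ∀ z : ℂ, ‖z‖ = 1 → Polynomial.aeval z x ≠ 0 := by
  obtain ⟨a, b, hab⟩ := h
  obtain ⟨κ, hκ0, hκ, E, hE, hgood⟩ := exists_multiplier hab
  set Z : Set ℂ := {z | ‖z‖ = 1 ∧ z ∈ E} ∪ {0} with hZ
  have hZfin : Z.Finite := (hE.subset fun z hz => hz.2).union (Set.finite_singleton 0)
  have hZκ : ∀ z ∈ Z, Polynomial.aeval z κ ≠ 0 := by
    rintro z (hz | hz)
    · exact hκ z hz.1
    · rw [Set.mem_singleton_iff.1 hz]; exact hκ0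
  let bad : ℂ → Set ℝ := fun z =>
    {c | Polynomial.aeval z b + c * Polynomial.aeval z κ * Polynomial.aeval z n = 0}
  have hbad : ∀ z ∈ Z, (bad z).Finite := fun z hz => by
    refine Set.Subsingleton.finite fun c₁ h₁ c₂ h₂ => ?_
    have h1 : Polynomial.aeval z b + c₁ * Polynomial.aeval z κ * Polynomial.aeval z n = 0 := h₁
    have h2 : Polynomial.aeval z b + c₂ * Polynomial.aeval z κ * Polynomial.aeval z n = 0 := h₂
    have hn : Polynomial.aeval z n ≠ 0 := by
      intro hn
      rw [hn, mul_zero, add_zero] at h1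
      exact aeval_ne_zero_of_bezout hab hn h1
    have h3 : (c₁ : ℂ) = c₂ := by
      refine mul_right_cancel₀ (mul_ne_zero (hZκ z hz) hn) ?_
      linear_combination h1 - h2
    exact_mod_cast h3
  obtain ⟨c, hc⟩ := ((hZfin.biUnion hbad).union (Set.finite_singleton 0)).exists_notMem
  have hc0 : c ≠ 0 := fun h => hc (Or.inr h)
  have hcZ : ∀ z ∈ Z, Polynomial.aeval z b
      + c * Polynomial.aeval z κ * Polynomial.aeval z n ≠ 0 := fun z hz h0 =>
    hc (Or.inl (Set.mem_biUnion hz h0))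
  have hval (z : ℂ) : Polynomial.aeval z (b + Polynomial.C c * κ * n) = Polynomial.aeval z b
      + c * Polynomial.aeval z κ * Polynomial.aeval z n := by
    simp
  refine ⟨b + Polynomial.C c * κ * n, a - Polynomial.C c * κ * d, ?_, ?_, ?_⟩
  · linear_combination hab
  · intro h0
    refine hcZ 0 (Or.inr rfl) ?_
    rw [← hval]
    have h1 := Polynomial.aeval_algebraMap_apply ℂ (0 : ℝ) (b + Polynomial.C c * κ * n)
    rw [map_zero] at h1
    rw [h1, Polynomial.coe_aeval_eq_eval, h0, map_zero]
  · intro z hz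
    rw [hval]
    by_cases hzE : z ∈ E
    · exact hcZ z (Or.inl ⟨hz, hzE⟩)
    · exact hgood z hz hzE c hc0
end

/-! Poles and properness of polynomials in `z⁻¹` and their quotients. -/

theorem polyInv_div_eq (p s : Polynomial ℝ) :
    polyInv p / polyInv s = algebraMap _ _ (Polynomial.reflect (max p.natDegree s.natDegree) p)
      / algebraMap _ (RatFunc ℝ) (Polynomial.reflect (max p.natDegree s.natDegree) s) := by
  rw [← polyInv_reflect _ p (le_max_left _ _), ← polyInv_reflect _ s (le_max_right _ _),
    mul_div_mul_right _ _ (pow_ne_zero _ RatFunc.X_ne_zero)]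

theorem isProperRat_algebraMap_div {A B : Polynomial ℝ} (hB : B ≠ 0) (h : A.degree ≤ B.degree) :
    IsProperRat (algebraMap _ _ A / algebraMap _ _ B) := by
  set f : RatFunc ℝ := algebraMap _ _ A / algebraMap _ _ B with hf
  have h1 : f.num * B = A * f.denom := (RatFunc.num_mul_eq_mul_denom_iff hB).2 hf
  rw [IsProperRat]
  have h2 := congrArg Polynomial.degree h1
  rw [Polynomial.degree_mul, Polynomial.degree_mul] at h2
  have h3 : f.num.degree + B.degree ≤ f.denom.degree + B.degree := by
    rw [h2, add_comm f.denom.degree]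
    gcongr
  rw [Polynomial.degree_eq_natDegree hB] at h3
  exact WithBot.le_of_add_le_add_right WithBot.coe_ne_bot h3

/-- The point `z = ∞` is `z⁻¹ = 0`: the coefficient of `z^N` in the reflected denominator is `s(0)`.
-/
theorem isProperRat_polyInv_div (p : Polynomial ℝ) {s : Polynomial ℝ} (hs : s.eval 0 ≠ 0) :
    IsProperRat (polyInv p / polyInv s) := by
  rw [polyInv_div_eq]
  set N := max p.natDegree s.natDegree
  have hc : (Polynomial.reflect N s).coeff N ≠ 0 := by
    rw [Polynomial.coeff_reflect, Polynomial.revAt_le le_rfl, Nat.sub_self,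
      Polynomial.coeff_zero_eq_eval_zero]
    exact hs
  refine isProperRat_algebraMap_div (fun h => hc (by rw [h, Polynomial.coeff_zero])) ?_
  refine le_trans ?_ (Polynomial.le_degree_of_ne_zero hc)
  rw [Polynomial.degree_le_iff_coeff_zero]
  intro k hk
  have hk' : N < k := by exact_mod_cast hk
  rw [Polynomial.coeff_reflect, Polynomial.revAt_eq_self_of_lt hk']
  exact Polynomial.coeff_eq_zero_of_natDegree_lt ((le_max_left _ _).trans_lt hk')

theorem denom_polyInv_div_ne_zero (p : Polynomial ℝ) {s : Polynomial ℝ} {z : ℂ} (hz : z ≠ 0)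
    (hs : Polynomial.aeval z⁻¹ s ≠ 0) :
    Polynomial.aeval z (polyInv p / polyInv s).denom ≠ 0 := by
  have h1 := aeval_reflect_eq (max p.natDegree s.natDegree) s (le_max_right _ _) hz
  have h2 : Polynomial.aeval z (Polynomial.reflect (max p.natDegree s.natDegree) s) ≠ 0 := by
    rw [h1]; exact mul_ne_zero (pow_ne_zero _ hz) hs
  have h3 : Polynomial.reflect (max p.natDegree s.natDegree) s ≠ 0 := by
    intro h; rw [h, map_zero] at h2; exact h2 rfl
  obtain ⟨c, hc⟩ := (RatFunc.denom_dvd h3).2 ⟨_, polyInv_div_eq p s⟩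
  rw [hc, map_mul] at h2
  exact left_ne_zero_of_mul h2

theorem isStrictlyStable_polyInv (p : Polynomial ℝ) : IsStrictlyStable (polyInv p) := by
  have h : polyInv p = polyInv p / polyInv 1 := by rw [map_one, div_one]
  rw [h]
  refine ⟨isProperRat_polyInv_div p (by simp), fun z hz => ?_⟩
  refine denom_polyInv_div_ne_zero p ?_ (by simp)
  rintro rfl
  norm_num at hz

/-! Existence of a stabilizing feedback. -/

/-- Clearing a common denominator `s(z⁻¹)` leaves a polynomial matrix in `z⁻¹`, to which the
diagonal factorization applies. -/
theorem exists_diagonal_polyInv {q m : ℕ} (F : Matrix (Fin q) (Fin m) (RatFunc ℝ)) :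
    ∃ (r : ℕ) (B : Matrix (Fin q) (Fin r) (Polynomial ℝ)) (B' : Matrix (Fin r) (Fin q) (Polynomial ℝ))
      (C : Matrix (Fin r) (Fin m) (Polynomial ℝ)) (C' : Matrix (Fin m) (Fin r) (Polynomial ℝ))
      (f : Fin r → RatFunc ℝ), B' * B = 1 ∧ C * C' = 1 ∧
        F = B.map polyInv * Matrix.diagonal f * C.map polyInv := by
  set s := ∏ i, ∏ j, (paraConj (F i j)).denom with hs
  have hs0 : s ≠ 0 := prod_denom_ne_zero (F.map paraConj)
  have hdvd (i j) : (paraConj (F i j)).denom ∣ s :=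
    (Finset.dvd_prod_of_mem (fun j => (paraConj (F i j)).denom) (Finset.mem_univ j)).trans
      (Finset.dvd_prod_of_mem (fun i => ∏ j, (paraConj (F i j)).denom) (Finset.mem_univ i))
  choose A hA using fun i j => (RatFunc.denom_dvd hs0).1 (hdvd i j)
  obtain ⟨r, B, B', C, C', a, hB, hC, hABC⟩ := Matrix.exists_diagonal_factorization (Matrix.of A)
  refine ⟨r, B, B', C, C', fun k => polyInv (a k) / polyInv s, hB, hC, ?_⟩
  have h1 : F = (polyInv s)⁻¹ • (Matrix.of A).map polyInv := by
    ext i j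
    rw [Matrix.smul_apply, Matrix.map_apply, Matrix.of_apply, smul_eq_mul, inv_mul_eq_div,
      ← paraConj_paraConj (F i j), hA, map_div₀, paraConj_algebraMap, paraConj_algebraMap]
  have h2 : (Matrix.diagonal fun k => polyInv (a k) / polyInv s)
      = (polyInv s)⁻¹ • (Matrix.diagonal a).map polyInv := by
    rw [Matrix.diagonal_map (map_zero _), ← Matrix.diagonal_smul]
    congr 1; ext k
    rw [Pi.smul_apply, smul_eq_mul, inv_mul_eq_div]
  have hmap {k l n : ℕ} (M : Matrix (Fin k) (Fin l) (Polynomial ℝ))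
      (M' : Matrix (Fin l) (Fin n) (Polynomial ℝ)) :
      (M * M').map polyInv = M.map polyInv * M'.map polyInv := Matrix.map_mul
  rw [h1, h2, hABC, hmap, hmap, Matrix.mul_smul, Matrix.smul_mul]

/-- The one-sided inverses of the outer factors decouple the loop into scalar loops `n_k / μ_k`,
each closed by a Bézout controller. Absence of poles of `H` on the circle is what later puts `H` in
`L²(Φ_y)`. -/
theorem exists_stabilizing_feedback {q m : ℕ} (F : Matrix (Fin q) (Fin m) (RatFunc ℝ)) :
    ∃ H : Matrix (Fin m) (Fin q) (RatFunc ℝ), IsInternallyStable F H ∧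
      (∀ i j, IsProperRat (H i j)) ∧
      ∀ i j (z : ℂ), ‖z‖ = 1 → Polynomial.aeval z (H i j).denom ≠ 0 := by
  obtain ⟨r, B, B', C, C', f, hB, hC, hF⟩ := exists_diagonal_polyInv F
  choose n μ hμ hcop hf using fun k => exists_coprime_polyInv_div (f k)
  choose x y hxy hx0 hxc using fun k => exists_bezout_ne_zero (hcop k)
  have hμ' (k) : polyInv (μ k) ≠ 0 := polyInv_ne_zero (hμ k)
  have hx' (k) : polyInv (x k) ≠ 0 := polyInv_ne_zero fun h => hx0 k (by simp [h])
  have hbez (k) : polyInv (x k) * polyInv (μ k) + polyInv (y k) * polyInv (n k) = 1 := by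
    rw [← map_mul, ← map_mul, ← map_add, hxy, map_one]
  have hmap {k l n : ℕ} (M : Matrix (Fin k) (Fin l) (Polynomial ℝ))
      (M' : Matrix (Fin l) (Fin n) (Polynomial ℝ)) :
      (M * M').map polyInv = M.map polyInv * M'.map polyInv := Matrix.map_mul
  have hdiag (v : Fin r → Polynomial ℝ) : (Matrix.diagonal v).map polyInv
      = Matrix.diagonal fun k => polyInv (v k) := Matrix.diagonal_map (map_zero _)
  have hone {k : ℕ} : (1 : Matrix (Fin k) (Fin k) (Polynomial ℝ)).map polyInv = 1 :=
    Matrix.map_one _ (map_zero _) (map_one _)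
  set b := B.map polyInv with hb
  set b' := B'.map polyInv with hb'
  set c := C.map polyInv with hc
  set c' := C'.map polyInv with hc'
  have hbb : b' * b = 1 := by rw [hb, hb', ← hmap, hB, hone]
  have hcc : c * c' = 1 := by rw [hc, hc', ← hmap, hC, hone]
  -- With this sign `1 - δ_k f_k = 1 / (x_k μ_k)` by Bézout, so its inverse is `x_k μ_k = 1 - y_k
  -- n_k`.
  set δ : Fin r → RatFunc ℝ := fun k => -polyInv (y k) / polyInv (x k) with hδ
  set H := c' * Matrix.diagonal δ * b' with hH
  -- The blocks of the closed loop, in the variable `z⁻¹`: `S = (I - H F)⁻¹`, `T = S H`, `U = F S`,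
  -- `V = I + F S H`. The denominators `x_k` and `μ_k` have cancelled.
  let S := 1 - C' * Matrix.diagonal (fun k => y k * n k) * C
  let T := -(C' * Matrix.diagonal (fun k => y k * μ k) * B')
  let U := B * Matrix.diagonal (fun k => n k * x k) * C
  let V := 1 - B * Matrix.diagonal (fun k => n k * y k) * B'
  have hS : S.map polyInv = 1 - c' * Matrix.diagonal (fun k => polyInv (y k * n k)) * c := by
    simp only [S]
    rw [Matrix.map_sub _ (map_sub _), hone, hmap, hmap, hdiag]
  have hT : T.map polyInv = -(c' * Matrix.diagonal (fun k => polyInv (y k * μ k)) * b') := by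
    simp only [T]
    rw [Matrix.map_neg _ (map_neg _), hmap, hmap, hdiag]
  have hU : U.map polyInv = b * Matrix.diagonal (fun k => polyInv (n k * x k)) * c := by
    simp only [U]
    rw [hmap, hmap, hdiag]
  have hV : V.map polyInv = 1 - b * Matrix.diagonal (fun k => polyInv (n k * y k)) * b' := by
    simp only [V]
    rw [Matrix.map_sub _ (map_sub _), hone, hmap, hmap, hdiag]
  have hbl {i j : ℕ} (v w : Fin r → RatFunc ℝ) (M : Matrix (Fin i) (Fin r) (RatFunc ℝ))
      (M' : Matrix (Fin r) (Fin j) (RatFunc ℝ)) :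
      M * Matrix.diagonal v * b' * (b * Matrix.diagonal w * M')
        = M * Matrix.diagonal (fun k => v k * w k) * M' := by
    rw [← Matrix.diagonal_mul_diagonal]
    calc _ = M * Matrix.diagonal v * (b' * b) * Matrix.diagonal w * M' := by
          simp only [Matrix.mul_assoc]
      _ = _ := by rw [hbb, Matrix.mul_one]; simp only [Matrix.mul_assoc]
  have hcl {i j : ℕ} (v w : Fin r → RatFunc ℝ) (M : Matrix (Fin i) (Fin r) (RatFunc ℝ))
      (M' : Matrix (Fin r) (Fin j) (RatFunc ℝ)) :
      M * Matrix.diagonal v * c * (c' * Matrix.diagonal w * M')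
        = M * Matrix.diagonal (fun k => v k * w k) * M' := by
    rw [← Matrix.diagonal_mul_diagonal]
    calc _ = M * Matrix.diagonal v * (c * c') * Matrix.diagonal w * M' := by
          simp only [Matrix.mul_assoc]
      _ = _ := by rw [hcc, Matrix.mul_one]; simp only [Matrix.mul_assoc]
  have hsub {i j : ℕ} (v w : Fin r → RatFunc ℝ) (M : Matrix (Fin i) (Fin r) (RatFunc ℝ))
      (M' : Matrix (Fin r) (Fin j) (RatFunc ℝ)) :
      M * Matrix.diagonal v * M' - M * Matrix.diagonal w * M'
        = M * Matrix.diagonal (fun k => v k - w k) * M' := by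
    rw [← Matrix.diagonal_sub, Matrix.mul_sub, Matrix.sub_mul]
  have hneg {i j : ℕ} (v : Fin r → RatFunc ℝ) (M : Matrix (Fin i) (Fin r) (RatFunc ℝ))
      (M' : Matrix (Fin r) (Fin j) (RatFunc ℝ)) :
      M * Matrix.diagonal (fun k => -v k) * M' = -(M * Matrix.diagonal v * M') := by
    rw [← Matrix.diagonal_neg, Matrix.mul_neg, Matrix.neg_mul]
  have hδ' (k) : δ k = -polyInv (y k) / polyInv (x k) := rfl
  have hright : loopMatrix F H * (Matrix.fromBlocks S T U V).map polyInv = 1 := by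
    rw [Matrix.fromBlocks_map, loopMatrix, Matrix.fromBlocks_multiply, ← Matrix.fromBlocks_one,
      Matrix.one_mul, Matrix.one_mul, Matrix.one_mul, Matrix.one_mul, Matrix.neg_mul,
      Matrix.neg_mul, Matrix.neg_mul, Matrix.neg_mul]
    congr 1
    · have hv : (fun k => δ k * polyInv (n k * x k)) = fun k => -polyInv (y k * n k) := by
        ext k; rw [hδ', map_mul, map_mul]; field_simp [hx' k]
      rw [hS, hU, hH, hbl, hv, hneg]
      abel
    · have hv : (fun k => δ k - δ k * polyInv (n k * y k)) = fun k => -polyInv (y k * μ k) := by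
        ext k
        rw [hδ', map_mul, map_mul]
        field_simp [hx' k]
        linear_combination polyInv (y k) * hbez k
      have hHV : H * V.map polyInv = -(c' * Matrix.diagonal (fun k => polyInv (y k * μ k)) * b') := by
        rw [hV, Matrix.mul_sub, Matrix.mul_one, hH, hbl, hsub, hv, hneg]
      rw [hHV, hT]
      abel
    · have hv : (fun k => f k - f k * polyInv (y k * n k)) = fun k => polyInv (n k * x k) := by
        ext k
        rw [hf, map_mul, map_mul]
        field_simp [hμ' k]
        linear_combination -polyInv (n k) * hbez k
      have hFS : F * S.map polyInv = b * Matrix.diagonal (fun k => polyInv (n k * x k)) * c := by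
        rw [hS, Matrix.mul_sub, Matrix.mul_one, hF, hcl, hsub, hv]
      rw [hFS, hU]
      abel
    · have hv : (fun k => f k * polyInv (y k * μ k)) = fun k => polyInv (n k * y k) := by
        ext k
        rw [hf, map_mul, map_mul]
        field_simp [hμ' k]
      have hFT : F * T.map polyInv = -(b * Matrix.diagonal (fun k => polyInv (n k * y k)) * b') := by
        rw [hT, Matrix.mul_neg, hF, hcl, hv]
      rw [hFT, hV]
      abel
  have hdet : IsUnit (loopMatrix F H).det := Matrix.isUnit_det_of_right_inverse hright
  refine ⟨H, ⟨hdet, fun i j => ?_⟩, ?_⟩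
  · rw [Matrix.inv_eq_right_inv hright, Matrix.map_apply]
    exact isStrictlyStable_polyInv _
  -- A common denominator for `H`. It inherits from the `x_k` that it is nonzero at `0` and on the
  -- circle.
  set X := ∏ k, x k with hX
  have hXdvd (k) : x k ∣ X := Finset.dvd_prod_of_mem _ (Finset.mem_univ k)
  choose e he using hXdvd
  have hX0 : polyInv X ≠ 0 := polyInv_ne_zero
    (Finset.prod_ne_zero_iff.2 fun k _ h => hx0 k (by simp [h]))
  have hHe : H = (polyInv X)⁻¹ • (C' * Matrix.diagonal (fun k => -(y k * e k)) * B').map polyInv := by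
    rw [hmap, hmap, hdiag, ← Matrix.smul_mul, ← Matrix.mul_smul, ← Matrix.diagonal_smul, hH]
    congr 3; ext k
    rw [Pi.smul_apply, smul_eq_mul, inv_mul_eq_div]
    simp only [hδ]
    rw [div_eq_div_iff (hx' k) hX0, he k]
    simp only [map_neg, map_mul]
    ring
  have hentry (i j) : H i j = polyInv ((C' * Matrix.diagonal (fun k => -(y k * e k)) * B') i j)
      / polyInv X := by
    rw [hHe, Matrix.smul_apply, Matrix.map_apply, smul_eq_mul, inv_mul_eq_div]
  constructor
  · intro i j
    rw [hentry]
    refine isProperRat_polyInv_div _ ?_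
    rw [hX, Polynomial.eval_prod]
    exact Finset.prod_ne_zero_iff.2 fun k _ => hx0 k
  · intro i j z hz
    rw [hentry]
    refine denom_polyInv_div_ne_zero _ (by rintro rfl; simp at hz) ?_
    rw [hX, map_prod]
    exact Finset.prod_ne_zero_iff.2 fun k _ => hxc k _ (by simp [hz])

/-! Rank considerations. -/

theorem Matrix.isUnit_det_of_rank_eq {K n : Type*} [Field K] [Fintype n] [DecidableEq n]
    {A : Matrix n n K} (h : A.rank = Fintype.card n) : IsUnit A.det := by
  rw [← Matrix.isUnit_iff_isUnit_det, ← Matrix.mulVec_surjective_iff_isUnit]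
  have h1 : LinearMap.range A.mulVecLin = ⊤ := by
    refine Submodule.eq_top_of_finrank_eq ?_
    rw [Module.finrank_fintype_fun_eq_card]
    exact h
  exact LinearMap.range_eq_top.1 h1

/-- If the principal submatrix on the rows and columns `a` has the rank of the whole matrix, the
Schur complement vanishes. -/
theorem Matrix.mul_submatrix_eq_of_rank {K ι n k : Type*} [Field K] [Fintype ι] [Fintype n]
    [DecidableEq n] (Φ : Matrix ι ι K) (a : n → ι) (b : k → ι)
    (hrank : Φ.rank = Fintype.card n) (hdet : IsUnit (Φ.submatrix a a).det) :
    Φ.submatrix b a * (Φ.submatrix a a)⁻¹ * Φ.submatrix a id = Φ.submatrix b id := by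
  ext i l
  by_contra hne
  let _ : Invertible (Φ.submatrix a a) := Matrix.invertibleOfIsUnitDet _ hdet
  -- The invertible block bordered by row `b i` and column `l`. Its determinant is that of the block
  -- times the Schur complement entry, so a nonzero entry would push the rank above that of `Φ`.
  let B : Matrix (n ⊕ Unit) (n ⊕ Unit) K :=
    Φ.submatrix (Sum.elim a fun _ => b i) (Sum.elim a fun _ => l)
  have hB : B = Matrix.fromBlocks (Φ.submatrix a a) (Φ.submatrix a fun _ => l)
      (Φ.submatrix (fun _ => b i) a) (Φ.submatrix (fun _ => b i) fun _ => l) := by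
    ext (r | r) (c | c) <;> rfl
  have hBdet : IsUnit B.det := by
    rw [hB, Matrix.det_fromBlocks₁₁, IsUnit.mul_iff]
    refine ⟨hdet, ?_⟩
    rw [Matrix.det_unique, isUnit_iff_ne_zero, Matrix.sub_apply, sub_ne_zero]
    refine fun h => hne ?_
    rw [Matrix.invOf_eq_nonsing_inv] at h
    exact h.symm
  have h1 := Matrix.rank_of_isUnit B ((Matrix.isUnit_iff_isUnit_det B).2 hBdet)
  have h2 : B.rank ≤ Φ.rank := Matrix.rank_submatrix_le _ _ _
  rw [h1, hrank, Fintype.card_sum, Fintype.card_unit] at h2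
  omega

section
variable {ι κ ν : Type*} [Fintype ι] [Fintype κ] [Fintype ν] {Ω : Type*} [MeasurableSpace Ω]
  {P : Measure Ω} {x : ℤ → Ω → ι → ℝ} {Φ : Matrix ι ι (RatFunc ℝ)} {a : κ → ι} {b : ν → ι}

theorem map_paraConj_mul {i k : Type*} (A : Matrix i κ (RatFunc ℝ)) (B : Matrix κ k (RatFunc ℝ)) :
    (A * B).map paraConj = A.map paraConj * B.map paraConj := Matrix.map_mul

theorem posOnCircle (hx : IsWideSenseStationary P x) (hΦ : IsSpectralDensity P x Φ) :
    PosOnCircle Φ := posSemidef_onCircle hx hΦ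

variable [DecidableEq ι]

/-- A filter that outputs one subvector when driven by another satisfies the corresponding linear
relation with the spectral density. -/
theorem IsFilterOutput.mul_selection_eq (hx : IsWideSenseStationary P x)
    (hΦ : IsSpectralDensity P x Φ) {F : Matrix ν κ (RatFunc ℝ)}
    (h : IsFilterOutput P (subprocess x a) (Φ.submatrix a a) F (subprocess x b)) :
    F * Φ.submatrix a id = Φ.submatrix b id := by
  have hpos := posOnCircle hx hΦ
  have h1 := h.isSpectralRep_mul_selection.onCircle_sub hx hpos (isSpectralRep_selection hx b)
  have h2 := h1.mul_eq_zero hx hΦ hpos fun t i => ae_of_all _ fun ω => by simp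
  rwa [Matrix.sub_mul, Matrix.mul_assoc, selection_mul, selection_mul, sub_eq_zero] at h2

/-- `F` may have poles on the circle, but the relation gives `F Φ_aa F* = Φ_bb` there almost
everywhere, so its `L²` norm equals that of the constant selection of `b`. -/
theorem specNormSq_lt_top_of_mul_eq (hx : IsWideSenseStationary P x)
    (hΦ : IsSpectralDensity P x Φ) {F : Matrix ν κ (RatFunc ℝ)}
    (hF : F * Φ.submatrix a id = Φ.submatrix b id) :
    specNormSq (Φ.submatrix a a) (onCircle F) < ⊤ := by
  have hpos := posOnCircle hx hΦ
  rw [← specNormSq_mul_selection]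
  have hK : (F * selection a) * Φ = selection b * Φ := by
    rw [Matrix.mul_assoc, selection_mul, selection_mul, hF]
  have heq : specNormSq Φ (onCircle (F * selection a)) = specNormSq Φ (onCircle (selection b)) := by
    simp only [specNormSq_eq]
    refine lintegral_congr_ae (ae_restrict_of_ae ?_)
    filter_upwards [onCircle_mul (F * selection a) Φ, onCircle_mul (selection b) Φ] with θ h1 h2
    rw [hK, h2] at h1
    have h3 := congrArg Matrix.conjTranspose h1
    rw [Matrix.conjTranspose_mul, Matrix.conjTranspose_mul, hpos.conjTranspose_eq] at h3
    simp only [traceForm]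
    rw [← h1, Matrix.mul_assoc, ← h3, ← Matrix.mul_assoc]
  rw [heq]
  refine specNormSq_lt_top_of_continuous (continuous_onCircle hΦ) fun i j => ?_
  simp only [onCircle_selection]
  exact continuous_const

/-- Conversely, such a relation makes one subvector the output of the filter. -/
theorem isFilterOutput_of_mul_eq (hx : IsWideSenseStationary P x)
    (hΦ : IsSpectralDensity P x Φ) {F : Matrix ν κ (RatFunc ℝ)}
    (hF : F * Φ.submatrix a id = Φ.submatrix b id) :
    IsFilterOutput P (subprocess x a) (Φ.submatrix a a) F (subprocess x b) := by
  have hpos := posOnCircle hx hΦ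
  have hxa := hx.subprocess a
  have hΦa := hΦ.subprocess a
  obtain ⟨s, hs⟩ := exists_isFilterOutput hxa hΦa (posOnCircle hxa hΦa) F
    (specNormSq_lt_top_of_mul_eq hx hΦ hF)
  have h1 := hs.isSpectralRep_mul_selection.onCircle_sub hx hpos (isSpectralRep_selection hx b)
  have h2 := h1.ae_eq_zero hx hΦ hpos (by
    rw [Matrix.sub_mul, Matrix.mul_assoc, selection_mul, selection_mul, hF, sub_self])
  exact (hs.isSpectralRep.congr hs.isSpectralRep.entryMeasurable (ae_of_all _ fun _ => rfl)
    fun t i => (h2 t i).mono fun ω hω => sub_eq_zero.1 hω).isFilterOutput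

/-- The residual `r = u - H y` of a feedback model has the spectral density
`(I - H F) Φ_u (I - H F)~`. -/
theorem residual_spectralDensity [DecidableEq κ] [IsProbabilityMeasure P] (hx : IsWideSenseStationary P x)
    (hΦ : IsSpectralDensity P x Φ) {F : Matrix ν κ (RatFunc ℝ)} {H : Matrix κ ν (RatFunc ℝ)}
    {r : ℤ → Ω → κ → ℝ} (hF : F * Φ.submatrix a id = Φ.submatrix b id)
    (hH : IsFilterOutput P (subprocess x b) (Φ.submatrix b b) H
      fun t ω i => subprocess x a t ω i - r t ω i) :
    IsWideSenseStationary P r ∧ IsSpectralDensity P r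
      ((1 - H * F) * Φ.submatrix a a * ((1 - H * F).map paraConj).transpose) := by
  have hpos := posOnCircle hx hΦ
  have hr : IsSpectralRep P x Φ (onCircle (selection a - H * selection b)) r := by
    have h1 := (isSpectralRep_selection hx a).onCircle_sub hx hpos hH.isSpectralRep_mul_selection
    simpa only [sub_sub_cancel] using h1
  have hd := hr.isSpectralDensity hx hΦ hpos
  -- Against `Φ`, the selection of `b` may be replaced by `F` times that of `a`; `hL'` is the
  -- para-conjugate transpose of this identity.
  have hL : (selection a - H * selection b) * Φ = (1 - H * F) * (selection a * Φ) := by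
    rw [Matrix.sub_mul, Matrix.mul_assoc, selection_mul, selection_mul, Matrix.sub_mul,
      Matrix.one_mul, Matrix.mul_assoc, hF]
  have hL' : Φ * ((selection a - H * selection b).map paraConj).transpose
      = Φ.submatrix id a * ((1 - H * F).map paraConj).transpose := by
    have h1 : (((selection a - H * selection b) * Φ).map paraConj).transpose
        = (((1 - H * F) * (selection a * Φ)).map paraConj).transpose := by rw [hL]
    rwa [map_paraConj_mul, map_paraConj_mul, map_paraConj_mul, Matrix.transpose_mul,
      Matrix.transpose_mul, Matrix.transpose_mul, paraConj_transpose_eq hpos,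
      selection_map_paraConj, mul_selection_transpose] at h1
  refine ⟨hd.isWideSenseStationary hr.memLp fun t i => hr.integral_eq_zero hx t i, ?_⟩
  have heq : (selection a - H * selection b) * Φ * ((selection a - H * selection b).map
      paraConj).transpose
      = (1 - H * F) * Φ.submatrix a a * ((1 - H * F).map paraConj).transpose := by
    rw [hL, Matrix.mul_assoc, Matrix.mul_assoc, hL', ← Matrix.mul_assoc (selection a),
      selection_mul, Matrix.submatrix_submatrix, ← Matrix.mul_assoc]
    rfl
  rwa [heq] at hd
end

/-- By the block determinant formula `I - H F` has the determinant of the loop matrix. -/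
theorem isUnit_det_one_sub_mul {ι κ : Type*} [Fintype ι] [Fintype κ] [DecidableEq ι]
    [DecidableEq κ] {F : Matrix κ ι (RatFunc ℝ)} {H : Matrix ι κ (RatFunc ℝ)}
    (h : IsInternallyStable F H) : IsUnit (1 - H * F).det := by
  have h1 := h.1
  rwa [loopMatrix, Matrix.det_fromBlocks_one₂₂, Matrix.neg_mul, Matrix.mul_neg, neg_neg] at h1

theorem isUnit_det_transpose_map_paraConj {ι : Type*} [Fintype ι] [DecidableEq ι]
    {A : Matrix ι ι (RatFunc ℝ)} (h : IsUnit A.det) :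
    IsUnit (A.map paraConj).transpose.det := by
  have h1 : (A.map paraConj).det = paraConj A.det := (paraConj.toRingHom.map_det A).symm
  rw [Matrix.det_transpose, h1]
  exact h.map paraConj

end

/-! ### The main theorem. -/

theorem theorem2 {Ω : Type*} [MeasurableSpace Ω] (P : Measure Ω) [IsProbabilityMeasure P]
    (p m q : ℕ) (ζ : ℤ → Ω → Fin p → ℝ) (Φ : Matrix (Fin p) (Fin p) (RatFunc ℝ))
    (hζ : IsWideSenseStationary P ζ) (hΦ : IsSpectralDensity P ζ Φ) (hrank : Φ.rank = m)
    (e : Fin m ⊕ Fin q ≃ Fin p)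
    (u : ℤ → Ω → Fin m → ℝ) (hu : u = subprocess ζ (fun i => e (Sum.inl i)))
    (y : ℤ → Ω → Fin q → ℝ) (hy : y = subprocess ζ (fun i => e (Sum.inr i)))
    (Φu : Matrix (Fin m) (Fin m) (RatFunc ℝ))
    (hΦu : Φu = Φ.submatrix (fun i => e (Sum.inl i)) (fun i => e (Sum.inl i)))
    (Φyu : Matrix (Fin q) (Fin m) (RatFunc ℝ))
    (hΦyu : Φyu = Φ.submatrix (fun i => e (Sum.inr i)) (fun i => e (Sum.inl i)))
    (Φy : Matrix (Fin q) (Fin q) (RatFunc ℝ))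
    (hΦy : Φy = Φ.submatrix (fun i => e (Sum.inr i)) (fun i => e (Sum.inr i)))
    (hfull : Φu.rank = m) :
    (∃ (F : Matrix (Fin q) (Fin m) (RatFunc ℝ)) (H : Matrix (Fin m) (Fin q) (RatFunc ℝ))
        (r : ℤ → Ω → Fin m → ℝ),
      IsFeedbackModel P u y Φu Φy F H r ∧ ∀ i j, IsProperRat (H i j)) ∧
    (∀ F : Matrix (Fin q) (Fin m) (RatFunc ℝ),
      IsFilterOutput P u Φu F y → F = Φyu * Φu⁻¹) ∧
    (∀ (F : Matrix (Fin q) (Fin m) (RatFunc ℝ)) (H : Matrix (Fin m) (Fin q) (RatFunc ℝ))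
        (r : ℤ → Ω → Fin m → ℝ),
      IsFeedbackModel P u y Φu Φy F H r →
        IsWideSenseStationary P r ∧
        ∃ Φr : Matrix (Fin m) (Fin m) (RatFunc ℝ), IsSpectralDensity P r Φr ∧ Φr.rank = m) := by
  subst hu hy hΦu hΦyu hΦy
  set a : Fin m → Fin p := fun i => e (Sum.inl i)
  set b : Fin q → Fin p := fun i => e (Sum.inr i)
  have hdet : IsUnit (Φ.submatrix a a).det := Matrix.isUnit_det_of_rank_eq (by simpa using hfull)
  refine ⟨?_, fun F hF => ?_, fun F H r hmodel => ?_⟩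
  · have hF := Matrix.mul_submatrix_eq_of_rank Φ a b (by simpa using hrank) hdet
    set F := Φ.submatrix b a * (Φ.submatrix a a)⁻¹
    obtain ⟨H, hstab, hprop, hpole⟩ := exists_stabilizing_feedback F
    have hyP := hζ.subprocess b
    have hyΦ := hΦ.subprocess b
    obtain ⟨w, hw⟩ := exists_isFilterOutput hyP hyΦ (posOnCircle hyP hyΦ) H
      (specNormSq_lt_top_of_continuous (continuous_onCircle hyΦ)
        fun i j => continuous_ratValue (hpole i j))
    refine ⟨F, H, fun t ω i => subprocess ζ a t ω i - w t ω i,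
      ⟨isFilterOutput_of_mul_eq hζ hΦ hF, ?_, hstab⟩, hprop⟩
    simpa only [sub_sub_cancel] using hw
  · have h1 := congrArg (fun M => M.submatrix id a) (hF.mul_selection_eq hζ hΦ)
    have h2 : F * Φ.submatrix a a = Φ.submatrix b a := h1
    rw [← h2, Matrix.mul_assoc, Matrix.mul_nonsing_inv _ hdet, Matrix.mul_one]
  · have hF := hmodel.forward.mul_selection_eq hζ hΦ
    obtain ⟨h1, h2⟩ := residual_spectralDensity hζ hΦ hF hmodel.feedback
    have hu := isUnit_det_one_sub_mul hmodel.stable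
    refine ⟨h1, _, h2, ?_⟩
    rw [Matrix.rank_of_isUnit, Fintype.card_fin]
    rw [Matrix.isUnit_iff_isUnit_det, Matrix.det_mul, Matrix.det_mul]
    exact (hu.mul hdet).mul (isUnit_det_transpose_map_paraConj hu)
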